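/- For $\kappa\in[0,1]$ let $T_\kappa:[-1,1]\to[-1,1]$ be the paired tent map \[ T_\kappa(x)=\begin{cases}2(1+\kappa)(x+1)-1,&x\in[-1,-1/2],\\-2(1+\kappa)x-1,&x\in[-1/2,0),\\0,&x=0,\\-2(1+\kappa)x+1,&x\in(0,1/2],\\2(1+\kappa)(x-1)+1,&x\in[1/2,1].\end{cases} \] For $n\ge1$ let $\kappa_n$ be the unique positive solution of $(2+2\kappa)^n\kappa=1$ (it lies in $(0,1/2)$). Let $R_1,\dots,R_{2n+4}$ be the open intervals between consecutive points of \[ -1<T_{\kappa_n}(-\kappa_n)<\dots<T_{\kappa_n}^{n-1}(-\kappa_n)<-\tfrac12<-\kappa_n<0<\kappa_n<\tfrac12<T_{\kappa_n}^{n-1}(\kappa_n)<\dots<T_{\kappa_n}(\kappa_n)<1 \] (the Markov partition of $T_{\kappa_n}$), let $A_n$ be the $(2n+4)\times(2n+4)$ matrix whose $(i,j)$ entry is $1$ if $R_i\subseteq T_{\kappa_n}(R_j)$ and $0$ otherwise, and let $M_n=(2(1+\kappa_n))^{-1}A_n$. Let $\lambda$ be normalized Lebesgue measure on $[-1,1]$,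 and let $BV\subset L^1(\lambda;\mathbb C)$ be the space of classes having a representative of bounded variation on $[-1,1]$. Let $P_n$ be the Perron–Frobenius operator of $T_{\kappa_n}$, that is, $P_nf$ is the Radon–Nikodym derivative with respect to $\lambda$ of $A\mapsto\int_{T_{\kappa_n}^{-1}(A)}f\,d\lambda$, considered as an operator on $BV$. Then there are real numbers $\mu_n$ such that for every $n\ge6$, both for $M_n$ and for $P_n$ acting on $BV$: $1$ is an eigenvalue of algebraic multiplicity one, $\mu_n$ is an eigenvalue, $|\mu_n|<1$, and every other point of the spectrum has modulus strictly less than $|\mu_n|$ (so $\mu_n$ is the second-largest eigenvalue in modulus). Moreover, as $n\to\infty$, \[ \mu_n\sim 1-2\kappa_n,\qquad\text{and more precisely}\qquad \mu_n=1-2\kappa_n+o(\kappa_n). \] Consequently the mixing time of $T_{\kappa_n}$ (up to a scale factor), defined as $1/|\log\rho_n|$ where $\rho_n$ is the largest modulus of a point other than $1$ of the spectrum of $P_n$ on $BV$, is asymptotically equivalent to $2^{n-1}$. -/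

import Mathlib

open MeasureTheory Set Filter Asymptotics
open scoped ENNReal NNReal

namespace PairedTent

/-! ### The paired tent maps and the parameters `κ_n` -/

/-- The paired tent map `T_κ` (a map of `[-1, 1]` to itself; its values outside `[-1, 1]` are
irrelevant). -/
noncomputable def tent (κ x : ℝ) : ℝ :=
  if x = 0 then 0
  else if x ≤ -1 / 2 then 2 * (1 + κ) * (x + 1) - 1
  else if x < 0 then -2 * (1 + κ) * x - 1
  else if x ≤ 1 / 2 then -2 * (1 + κ) * x + 1
  else 2 * (1 + κ) * (x - 1) + 1

theorem exists_kappa (n : ℕ) : ∃ κ : ℝ, (0 < κ ∧ κ ≤ 1) ∧ (2 + 2 * κ) ^ n * κ = 1 := by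
  have hc : ContinuousOn (fun κ : ℝ => (2 + 2 * κ) ^ n * κ) (Icc 0 1) := by fun_prop
  have h4 : (1 : ℝ) ≤ (2 + 2 * 1) ^ n * 1 := by
    have : (1 : ℝ) ≤ (2 + 2 * 1) ^ n := one_le_pow₀ (by norm_num)
    linarith
  obtain ⟨κ, hκ, h⟩ := intermediate_value_Icc (zero_le_one' ℝ) hc
    (show (1 : ℝ) ∈ Icc _ _ from ⟨by simp, h4⟩)
  refine ⟨κ, ⟨lt_of_le_of_ne hκ.1 ?_, hκ.2⟩, h⟩
  rintro rfl
  simp at h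

/-- `κ_n`, the positive solution of `(2 + 2κ)^n κ = 1`. -/
noncomputable def kappa (n : ℕ) : ℝ := Classical.choose (exists_kappa n)

theorem kappa_pos (n : ℕ) : 0 < kappa n := (Classical.choose_spec (exists_kappa n)).1.1

theorem kappa_le_one (n : ℕ) : kappa n ≤ 1 := (Classical.choose_spec (exists_kappa n)).1.2

theorem kappa_eq (n : ℕ) : (2 + 2 * kappa n) ^ n * kappa n = 1 :=
  (Classical.choose_spec (exists_kappa n)).2

/-- The defining equation has only one positive solution. -/
theorem kappa_unique (n : ℕ) {κ : ℝ} (h0 : 0 < κ) (h : (2 + 2 * κ) ^ n * κ = 1) :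
    κ = kappa n := by
  have hmono : StrictMonoOn (fun x : ℝ => (2 + 2 * x) ^ n * x) (Ioi 0) := by
    intro x hx y hy hxy
    have hx' : (0 : ℝ) < x := hx
    have h1 : (2 + 2 * x) ^ n ≤ (2 + 2 * y) ^ n :=
      pow_le_pow_left₀ (by linarith) (by linarith) n
    have h2 : (0 : ℝ) < (2 + 2 * x) ^ n := by positivity
    exact mul_lt_mul' h1 hxy hx'.le (h2.trans_le h1)
  exact hmono.injOn h0 (kappa_pos n) (by simp only [h, kappa_eq])

theorem kappa_lt_half {n : ℕ} (hn : 1 ≤ n) : kappa n < 1 / 2 := by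
  by_contra hc
  push Not at hc
  have h1 : (3 : ℝ) ^ n ≤ (2 + 2 * kappa n) ^ n :=
    pow_le_pow_left₀ (by norm_num) (by linarith) n
  have h2 : (3 : ℝ) ^ 1 ≤ 3 ^ n := pow_le_pow_right₀ (by norm_num) hn
  have h3 := kappa_eq n
  nlinarith

/-! ### The Markov partition and the matrices `A_n`, `M_n` -/

/-- The endpoints `r_0 < r_1 < ⋯ < r_{2n+4}` of the Markov partition of `T_{κ_n}` (`n ≥ 1`):
`-1, T(-κ_n), …, T^{n-1}(-κ_n), -1/2, -κ_n, 0, κ_n, 1/2, T^{n-1}(κ_n), …, T(κ_n), 1`. -/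
noncomputable def endpt (n i : ℕ) : ℝ :=
  if i = 0 then -1
  else if i < n then (tent (kappa n))^[i] (-kappa n)
  else if i = n then -1 / 2
  else if i = n + 1 then -kappa n
  else if i = n + 2 then 0
  else if i = n + 3 then kappa n
  else if i = n + 4 then 1 / 2
  else if i < 2 * n + 4 then (tent (kappa n))^[2 * n + 4 - i] (kappa n)
  else 1

/-- The `2n + 4` open intervals of the Markov partition of `T_{κ_n}`, from left to right. -/
noncomputable def cell (n : ℕ) (i : Fin (2 * n + 4)) : Set ℝ :=
  Ioo (endpt n i) (endpt n (i + 1))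

open Classical in
/-- The adjacency matrix `A_n`: the `(i, j)` entry is `1` if `R_i ⊆ T(R_j)` and `0` otherwise. -/
noncomputable def adjMatrix (n : ℕ) : Matrix (Fin (2 * n + 4)) (Fin (2 * n + 4)) ℂ :=
  Matrix.of fun i j => if cell n i ⊆ tent (kappa n) '' cell n j then 1 else 0

/-- `M_n = (2 (1 + κ_n))⁻¹ A_n`. -/
noncomputable def markovMatrix (n : ℕ) : Matrix (Fin (2 * n + 4)) (Fin (2 * n + 4)) ℂ :=
  ((2 * (1 + kappa n) : ℝ) : ℂ)⁻¹ • adjMatrix n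

/-! ### The Perron–Frobenius operator on `L¹` and the space `BV` -/

/-- The Perron–Frobenius operator of `T` on `L¹(μ)`: `P f` is the Radon–Nikodym derivative with
respect to `μ` of the complex measure `A ↦ ∫_{T⁻¹ A} f dμ`. -/
noncomputable def pfL1 {X : Type*} [MeasurableSpace X] (μ : Measure X) (T : X → X)
    (f : Lp ℂ 1 μ) : Lp ℂ 1 μ :=
  (ComplexMeasure.integrable_rnDeriv ((μ.withDensityᵥ f).map T) μ).toL1 _

/-- Normalized Lebesgue measure on `[-1, 1]`. -/
noncomputable def leb : Measure ℝ := (2 : ℝ≥0∞)⁻¹ • volume.restrict (Icc (-1) 1)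

instance : IsFiniteMeasure leb := by
  refine ⟨?_⟩
  simp only [leb, Measure.smul_apply, Measure.restrict_apply MeasurableSet.univ, univ_inter,
    Real.volume_Icc, smul_eq_mul]
  exact ENNReal.mul_lt_top (by simp) (by simp)

theorem bv_of_edist_le {f g h : ℝ → ℂ} {s : Set ℝ} (C D : ℝ≥0)
    (hf : BoundedVariationOn f s) (hg : BoundedVariationOn g s)
    (H : ∀ x ∈ s, ∀ y ∈ s, edist (h x) (h y) ≤ C * edist (f x) (f y) + D * edist (g x) (g y)) :
    BoundedVariationOn h s := by
  have hle : eVariationOn h s ≤ C * eVariationOn f s + D * eVariationOn g s := by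
    refine iSup_le fun p => ?_
    calc ∑ i ∈ Finset.range p.1, edist (h (p.2.1 (i + 1))) (h (p.2.1 i))
        ≤ ∑ i ∈ Finset.range p.1, (C * edist (f (p.2.1 (i + 1))) (f (p.2.1 i))
            + D * edist (g (p.2.1 (i + 1))) (g (p.2.1 i))) :=
          Finset.sum_le_sum fun i _ => H _ (p.2.2.2 _) _ (p.2.2.2 _)
      _ = C * ∑ i ∈ Finset.range p.1, edist (f (p.2.1 (i + 1))) (f (p.2.1 i))
            + D * ∑ i ∈ Finset.range p.1, edist (g (p.2.1 (i + 1))) (g (p.2.1 i)) := by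
          rw [Finset.sum_add_distrib, Finset.mul_sum, Finset.mul_sum]
      _ ≤ _ := by
          gcongr
          · exact eVariationOn.sum_le p.2.2.1 p.2.2.2
          · exact eVariationOn.sum_le p.2.2.1 p.2.2.2
  refine ne_top_of_le_ne_top ?_ hle
  exact ENNReal.add_ne_top.2 ⟨ENNReal.mul_ne_top (by simp) hf, ENNReal.mul_ne_top (by simp) hg⟩

theorem bv_add {f g : ℝ → ℂ} {s : Set ℝ} (hf : BoundedVariationOn f s)
    (hg : BoundedVariationOn g s) : BoundedVariationOn (f + g) s := by
  refine bv_of_edist_le 1 1 hf hg fun x _ y _ => ?_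
  simpa using edist_add_add_le (f x) (g x) (f y) (g y)

theorem bv_smul (c : ℂ) {f : ℝ → ℂ} {s : Set ℝ} (hf : BoundedVariationOn f s) :
    BoundedVariationOn (c • f) s := by
  refine bv_of_edist_le ‖c‖₊ 0 hf hf fun x _ y _ => ?_
  have h : edist (c • f x) (c • f y) = (‖c‖₊ : ℝ≥0∞) * edist (f x) (f y) := edist_smul₀ c _ _
  simpa using h.le

/-- The space `BV` of (classes of) complex functions of bounded variation on `[-1, 1]`, as a
subspace of `L¹`. -/
noncomputable def BV : Submodule ℂ (Lp ℂ 1 leb) where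
  carrier := {f | ∃ g : ℝ → ℂ, BoundedVariationOn g (Icc (-1) 1) ∧ f =ᵐ[leb] g}
  zero_mem' := ⟨0, by
    refine (eVariationOn.constant_on ?_).trans_ne ENNReal.zero_ne_top
    exact fun a ⟨x, _, hx⟩ b ⟨y, _, hy⟩ => by simp [← hx, ← hy], Lp.coeFn_zero _ _ _⟩
  add_mem' := by
    rintro f₁ f₂ ⟨g₁, hg₁, h₁⟩ ⟨g₂, hg₂, h₂⟩
    exact ⟨g₁ + g₂, bv_add hg₁ hg₂, (Lp.coeFn_add f₁ f₂).trans (h₁.add h₂)⟩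
  smul_mem' := by
    rintro c f ⟨g, hg, h⟩
    exact ⟨c • g, bv_smul c hg, (Lp.coeFn_smul c f).trans (h.const_smul c)⟩

/-! ### `P_κ` is linear and preserves `BV` -/

/-- On `brSet b`, an interval of length `1/2` starting at `brLeft b`, the map `T_κ` is
`y ↦ brSlope κ b * y + brConst κ b` (except at `0`). -/
noncomputable def brLeft : Fin 4 → ℝ := ![-1, -1 / 2, 0, 1 / 2]

noncomputable def brSlope (κ : ℝ) : Fin 4 → ℝ :=
  ![2 * (1 + κ), -(2 * (1 + κ)), -(2 * (1 + κ)), 2 * (1 + κ)]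

noncomputable def brConst (κ : ℝ) : Fin 4 → ℝ :=
  ![2 * (1 + κ) - 1, -1, 1, 1 - 2 * (1 + κ)]

noncomputable def brSet (b : Fin 4) : Set ℝ := Ico (brLeft b) (brLeft b + 1 / 2)

/-- The explicit formula `∑_{T y = x} f(y) / |T'(y)|` for the Perron–Frobenius operator. -/
noncomputable def pfFormula (κ : ℝ) (f : ℝ → ℂ) (x : ℝ) : ℂ :=
  ∑ b : Fin 4, ((|brSlope κ b|⁻¹ : ℝ) : ℂ) *
    (brSet b).indicator f ((x - brConst κ b) / brSlope κ b)

theorem measurable_tent (κ : ℝ) : Measurable (tent κ) := by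
  unfold tent
  refine Measurable.ite (measurableSet_singleton 0) measurable_const ?_
  refine Measurable.ite measurableSet_Iic (by fun_prop) ?_
  refine Measurable.ite measurableSet_Iio (by fun_prop) ?_
  exact Measurable.ite measurableSet_Iic (by fun_prop) (by fun_prop)

theorem mem_brSet_iff (b : Fin 4) (y : ℝ) :
    y ∈ brSet b ↔ brLeft b ≤ y ∧ y < brLeft b + 1 / 2 := Iff.rfl

theorem tent_eq {κ y : ℝ} (b : Fin 4) (hy : y ∈ brSet b) (h0 : y ≠ 0) :
    tent κ y = brSlope κ b * y + brConst κ b := by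
  rw [mem_brSet_iff] at hy
  obtain ⟨h1, h2⟩ := hy
  unfold tent
  fin_cases b <;> simp [brLeft, brSlope, brConst] at h1 h2 ⊢
  all_goals
    rw [if_neg h0]
    split_ifs <;> first
      | ring1
      | (exfalso; linarith)
      | (obtain rfl : y = -1 / 2 := by linarith
         ring1)
      | (obtain rfl : y = 1 / 2 := by linarith
         ring1)

theorem branch_mem {κ y : ℝ} (h0 : 0 ≤ κ) (h1 : κ ≤ 1) (b : Fin 4) (hy : y ∈ brSet b) :
    brSlope κ b * y + brConst κ b ∈ Icc (-1 : ℝ) 1 := by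
  rw [mem_brSet_iff] at hy
  obtain ⟨h2, h3⟩ := hy
  fin_cases b <;> simp [brLeft, brSlope, brConst] at h2 h3 ⊢ <;> constructor <;> nlinarith

theorem brSlope_ne {κ : ℝ} (h0 : 0 ≤ κ) (b : Fin 4) : brSlope κ b ≠ 0 := by
  fin_cases b <;> simp [brSlope] <;> linarith

theorem brSet_subset (b : Fin 4) : brSet b ⊆ Icc (-1 : ℝ) 1 := by
  intro y hy
  rw [mem_brSet_iff] at hy
  obtain ⟨h2, h3⟩ := hy
  fin_cases b <;> simp [brLeft] at h2 h3 ⊢ <;> constructor <;> linarith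

theorem sum_indicator_brSet (F : ℝ → ℂ) {y : ℝ} (h1 : y ≠ 1) :
    ∑ b : Fin 4, (brSet b).indicator F y = (Icc (-1) 1).indicator F y := by
  have e0 : brSet 0 = Ico (-1 : ℝ) (-1 / 2) := by
    have : brLeft 0 = -1 := rfl
    rw [brSet, this]
    norm_num
  have e1 : brSet 1 = Ico (-1 / 2 : ℝ) 0 := by
    have : brLeft 1 = -1 / 2 := rfl
    rw [brSet, this]
    norm_num
  have e2 : brSet 2 = Ico (0 : ℝ) (1 / 2) := by
    have : brLeft 2 = 0 := rfl
    rw [brSet, this]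
    norm_num
  have e3 : brSet 3 = Ico (1 / 2 : ℝ) 1 := by
    have : brLeft 3 = 1 / 2 := rfl
    rw [brSet, this]
    norm_num
  rw [Fin.sum_univ_four, e0, e1, e2, e3]
  simp only [indicator, mem_Ico, mem_Icc]
  rcases lt_or_ge y (-1) with h | h
  · rw [if_neg, if_neg, if_neg, if_neg, if_neg] <;> first
      | (intro hh; linarith [hh.1, hh.2])
      | simp
  rcases lt_or_ge y (-1 / 2) with h' | h'
  · rw [if_pos, if_neg, if_neg, if_neg, if_pos] <;> first
      | (intro hh; linarith [hh.1, hh.2])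
      | (constructor <;> linarith)
      | simp
  rcases lt_or_ge y 0 with h'' | h''
  · rw [if_neg, if_pos, if_neg, if_neg, if_pos] <;> first
      | (intro hh; linarith [hh.1, hh.2])
      | (constructor <;> linarith)
      | simp
  rcases lt_or_ge y (1 / 2) with h3 | h3
  · rw [if_neg, if_neg, if_pos, if_neg, if_pos] <;> first
      | (intro hh; linarith [hh.1, hh.2])
      | (constructor <;> linarith)
      | simp
  rcases lt_or_ge y 1 with h4 | h4
  · rw [if_neg, if_neg, if_neg, if_pos, if_pos] <;> first
      | (intro hh; linarith [hh.1, hh.2])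
      | (constructor <;> linarith)
      | simp
  · have h5 : 1 < y := lt_of_le_of_ne h4 (Ne.symm h1)
    rw [if_neg, if_neg, if_neg, if_neg, if_neg] <;> first
      | (intro hh; linarith [hh.1, hh.2])
      | simp

theorem integrable_leb_iff {f : ℝ → ℂ} : Integrable f leb ↔ IntegrableOn f (Icc (-1) 1) := by
  rw [leb, integrable_smul_measure (by simp) (by simp), IntegrableOn]

theorem setIntegral_leb (f : ℝ → ℂ) {A : Set ℝ} (hA : MeasurableSet A) :
    ∫ x in A, f x ∂leb = (2 : ℝ)⁻¹ • ∫ x, A.indicator ((Icc (-1) 1).indicator f) x := by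
  rw [leb, Measure.restrict_smul, integral_smul_measure, integral_indicator hA,
    Measure.restrict_restrict hA, setIntegral_indicator measurableSet_Icc]
  simp

theorem integrable_branch {κ : ℝ} (h0 : 0 ≤ κ) {f : ℝ → ℂ} (hf : Integrable f leb) (b : Fin 4) :
    Integrable (fun x => (brSet b).indicator f ((x - brConst κ b) / brSlope κ b)) := by
  have hF : Integrable ((brSet b).indicator f) :=
    (integrable_indicator_iff measurableSet_Ico).2
      ((integrable_leb_iff.1 hf).mono_set (brSet_subset b))
  exact (hF.comp_div (brSlope_ne h0 b)).comp_sub_right (brConst κ b)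

theorem integrable_pfFormula {κ : ℝ} (h0 : 0 ≤ κ) {f : ℝ → ℂ} (hf : Integrable f leb) :
    Integrable (pfFormula κ f) leb := by
  refine integrable_leb_iff.2 (Integrable.integrableOn ?_)
  unfold pfFormula
  exact integrable_finsetSum _ fun b _ => (integrable_branch h0 hf b).const_mul _

/-- `∫_{T⁻¹ A} f = ∫_A P f` with `P f` given by the explicit formula. -/
theorem setIntegral_pfFormula {κ : ℝ} (h0 : 0 ≤ κ) (h1 : κ ≤ 1) {f : ℝ → ℂ}
    (hf : Integrable f leb) {A : Set ℝ} (hA : MeasurableSet A) :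
    ∫ x in tent κ ⁻¹' A, f x ∂leb = ∫ x in A, pfFormula κ f x ∂leb := by
  rw [setIntegral_leb _ hA, setIntegral_leb _ (measurable_tent κ hA)]
  congr 1
  set a := brSlope κ with ha
  set c := brConst κ with hc
  let K : Fin 4 → ℝ → ℂ := fun b =>
    ((fun y => a b * y + c b) ⁻¹' A).indicator ((brSet b).indicator f)
  have hpre : ∀ b, MeasurableSet ((fun y => a b * y + c b) ⁻¹' A) := fun b =>
    (show Measurable fun y : ℝ => a b * y + c b by fun_prop) hA
  have hF : ∀ b, Integrable ((brSet b).indicator f) := fun b =>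
    (integrable_indicator_iff measurableSet_Ico).2
      ((integrable_leb_iff.1 hf).mono_set (brSet_subset b))
  have hK : ∀ b, Integrable (K b) := fun b => (hF b).indicator (hpre b)
  have hne : ∀ᵐ y : ℝ, y ≠ 0 ∧ y ≠ 1 :=
    (Measure.ae_ne volume 0).and (Measure.ae_ne volume 1)
  have hL : ∫ y, (tent κ ⁻¹' A).indicator ((Icc (-1) 1).indicator f) y = ∑ b, ∫ y, K b y := by
    rw [← integral_finsetSum _ fun b _ => hK b]
    refine integral_congr_ae ?_
    filter_upwards [hne] with y hy
    have h2 := sum_indicator_brSet ((tent κ ⁻¹' A).indicator f) hy.2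
    rw [indicator_indicator, inter_comm, ← indicator_indicator, ← h2]
    refine Finset.sum_congr rfl fun b _ => ?_
    by_cases hyb : y ∈ brSet b
    · have := tent_eq (κ := κ) b hyb hy.1
      have hiff : y ∈ tent κ ⁻¹' A ↔ y ∈ (fun y => a b * y + c b) ⁻¹' A := by
        simp only [mem_preimage, this, ha, hc]
      rw [indicator_of_mem hyb]
      by_cases hm : y ∈ tent κ ⁻¹' A
      · rw [indicator_of_mem hm]
        simp only [K]
        rw [indicator_of_mem (hiff.1 hm), indicator_of_mem hyb]
      · rw [indicator_of_notMem hm]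
        simp only [K]
        rw [indicator_of_notMem (mt hiff.2 hm)]
    · simp only [K, indicator, hyb, if_false, ite_self]
  have hR : ∀ x, A.indicator ((Icc (-1) 1).indicator (pfFormula κ f)) x =
      ∑ b, ((|a b|⁻¹ : ℝ) : ℂ) * K b ((x - c b) / a b) := by
    intro x
    have hx : ∀ b, a b * ((x - c b) / a b) + c b = x := fun b => by
      have := brSlope_ne h0 b
      simp only [ha]
      field_simp
      ring
    by_cases hxA : x ∈ A
    · have hKx : ∀ b, K b ((x - c b) / a b) = (brSet b).indicator f ((x - c b) / a b) := fun b =>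
        indicator_of_mem (by simpa only [mem_preimage, hx b] using hxA) _
      rw [indicator_of_mem hxA]
      simp only [hKx]
      by_cases hxI : x ∈ Icc (-1 : ℝ) 1
      · rw [indicator_of_mem hxI]
        rfl
      · rw [indicator_of_notMem hxI]
        refine (Finset.sum_eq_zero fun b _ => ?_).symm
        rw [indicator_of_notMem, mul_zero]
        intro hb
        have := branch_mem h0 h1 b hb
        rw [← ha, ← hc, hx b] at this
        exact hxI this
    · rw [indicator_of_notMem hxA]
      refine (Finset.sum_eq_zero fun b _ => ?_).symm
      have : K b ((x - c b) / a b) = 0 :=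
        indicator_of_notMem (by simpa only [mem_preimage, hx b] using hxA) _
      rw [this, mul_zero]
  simp only [hR]
  rw [hL, integral_finsetSum]
  · refine Finset.sum_congr rfl fun b _ => ?_
    rw [integral_const_mul, integral_sub_right_eq_self (fun x => K b (x / a b)) (c b),
      Measure.integral_comp_div, Complex.real_smul, ← mul_assoc, ← Complex.ofReal_mul,
      inv_mul_cancel₀ (abs_ne_zero.2 (brSlope_ne h0 b)), Complex.ofReal_one, one_mul]
  · intro b _
    exact (((hK b).comp_div (brSlope_ne h0 b)).comp_sub_right (c b)).const_mul _

theorem complexRnDeriv_ae_eq {c : ComplexMeasure ℝ} {g : ℝ → ℂ} (hg : Integrable g leb)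
    (h : c = leb.withDensityᵥ g) : c.rnDeriv leb =ᵐ[leb] g := by
  have hre : Integrable (fun x => (g x).re) leb := hg.re
  have him : Integrable (fun x => (g x).im) leb := hg.im
  have h1 : (fun x => (g x).re) =ᵐ[leb] (ComplexMeasure.re c).rnDeriv leb := by
    refine SignedMeasure.eq_rnDeriv 0 _ hre VectorMeasure.MutuallySingular.zero_left ?_
    rw [zero_add]
    ext A hA
    rw [withDensityᵥ_apply hre hA]
    have : (ComplexMeasure.re c) A = (c A).re := rfl
    rw [this, h, withDensityᵥ_apply hg hA]
    exact (integral_re hg.integrableOn).symm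
  have h2 : (fun x => (g x).im) =ᵐ[leb] (ComplexMeasure.im c).rnDeriv leb := by
    refine SignedMeasure.eq_rnDeriv 0 _ him VectorMeasure.MutuallySingular.zero_left ?_
    rw [zero_add]
    ext A hA
    rw [withDensityᵥ_apply him hA]
    have : (ComplexMeasure.im c) A = (c A).im := rfl
    rw [this, h, withDensityᵥ_apply hg hA]
    exact (integral_im hg.integrableOn).symm
  filter_upwards [h1, h2] with x hx hy
  exact Complex.ext hx.symm hy.symm

theorem pfL1_ae_eq {κ : ℝ} (h0 : 0 ≤ κ) (h1 : κ ≤ 1) (f : Lp ℂ 1 leb) {g : ℝ → ℂ}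
    (hfg : f =ᵐ[leb] g) : pfL1 leb (tent κ) f =ᵐ[leb] pfFormula κ g := by
  have hf : Integrable f leb := L1.integrable_coeFn f
  have hg : Integrable g leb := hf.congr hfg
  refine (Integrable.coeFn_toL1 _).trans (complexRnDeriv_ae_eq (integrable_pfFormula h0 hg) ?_)
  ext1 A hA
  rw [VectorMeasure.map_apply _ (measurable_tent κ) hA,
    withDensityᵥ_apply hf (measurable_tent κ hA),
    withDensityᵥ_apply (integrable_pfFormula h0 hg) hA, ← setIntegral_pfFormula h0 h1 hg hA]
  exact integral_congr_ae (ae_restrict_of_ae hfg)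

theorem pfL1_add {κ : ℝ} (h0 : 0 ≤ κ) (h1 : κ ≤ 1) (f g : Lp ℂ 1 leb) :
    pfL1 leb (tent κ) (f + g) = pfL1 leb (tent κ) f + pfL1 leb (tent κ) g := by
  refine Lp.ext ?_
  filter_upwards [pfL1_ae_eq h0 h1 (f + g) (Lp.coeFn_add f g), pfL1_ae_eq h0 h1 f .rfl,
    pfL1_ae_eq h0 h1 g .rfl, Lp.coeFn_add (pfL1 leb (tent κ) f) (pfL1 leb (tent κ) g)]
    with x e1 e2 e3 e4
  rw [e4, Pi.add_apply, e1, e2, e3]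
  simp only [pfFormula, indicator_add', Pi.add_apply, mul_add, Finset.sum_add_distrib]

theorem pfL1_smul {κ : ℝ} (h0 : 0 ≤ κ) (h1 : κ ≤ 1) (c : ℂ) (f : Lp ℂ 1 leb) :
    pfL1 leb (tent κ) (c • f) = c • pfL1 leb (tent κ) f := by
  refine Lp.ext ?_
  filter_upwards [pfL1_ae_eq h0 h1 (c • f) (Lp.coeFn_smul c f), pfL1_ae_eq h0 h1 f .rfl,
    Lp.coeFn_smul c (pfL1 leb (tent κ) f)] with x e1 e2 e3
  rw [e3, Pi.smul_apply, e1, e2]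
  simp only [pfFormula, smul_eq_mul, Finset.mul_sum]
  refine Finset.sum_congr rfl fun b _ => ?_
  have : (brSet b).indicator (c • (f : ℝ → ℂ)) = fun y => c * (brSet b).indicator f y := by
    ext y
    simp [indicator]
  rw [this]
  ring

theorem bv_step (a : ℝ) : BoundedVariationOn (fun x : ℝ => if a ≤ x then (1 : ℂ) else 0) univ := by
  have h : BoundedVariationOn (fun x : ℝ => if a ≤ x then (1 : ℝ) else 0) univ := by
    refine MonotoneOn.boundedVariationOn (C := 1) ?_ ?_
    · intro x _ y _ hxy
      dsimp only
      split_ifs <;> linarith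
    · intro x _
      split_ifs <;> norm_num
  have h2 := Complex.isometry_ofReal.lipschitz.comp_boundedVariationOn h
  convert h2 using 1
  ext x
  simp only [Function.comp]
  split_ifs <;> simp

theorem bv_bound {g : ℝ → ℂ} {s : Set ℝ} (hg : BoundedVariationOn g s) :
    ∃ C : ℝ≥0, ∀ x ∈ s, ‖g x‖₊ ≤ C := by
  rcases s.eq_empty_or_nonempty with rfl | ⟨x₀, hx₀⟩
  · exact ⟨0, by simp⟩
  refine ⟨‖g x₀‖₊ + (eVariationOn g s).toNNReal, fun x hx => ?_⟩
  have h := hg.dist_le hx hx₀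
  rw [← NNReal.coe_le_coe]
  push_cast
  have h2 : ‖g x‖ ≤ ‖g x₀‖ + dist (g x) (g x₀) := by
    rw [dist_eq_norm]
    have := norm_add_le (g x₀) (g x - g x₀)
    simpa using this
  exact h2.trans (by gcongr)

theorem bv_mul {f g : ℝ → ℂ} {s : Set ℝ} (hf : BoundedVariationOn f s)
    (hg : BoundedVariationOn g s) : BoundedVariationOn (f * g) s := by
  obtain ⟨C, hC⟩ := bv_bound hf
  obtain ⟨D, hD⟩ := bv_bound hg
  refine bv_of_edist_le D C hf hg fun x hx y hy => ?_
  simp only [edist_nndist, nndist_eq_nnnorm, Pi.mul_apply]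
  norm_cast
  calc ‖f x * g x - f y * g y‖₊ = ‖(f x - f y) * g x + f y * (g x - g y)‖₊ := by ring_nf
    _ ≤ ‖f x - f y‖₊ * ‖g x‖₊ + ‖f y‖₊ * ‖g x - g y‖₊ := by
        rw [← nnnorm_mul, ← nnnorm_mul]
        exact nnnorm_add_le _ _
    _ ≤ D * ‖f x - f y‖₊ + C * ‖g x - g y‖₊ := by
        rw [mul_comm D]
        gcongr
        · exact hD x hx
        · exact hC y hy

theorem bv_indicator {g : ℝ → ℂ} (hg : BoundedVariationOn g (Icc (-1) 1)) (b : Fin 4) :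
    BoundedVariationOn ((brSet b).indicator g) univ := by
  have hcl : BoundedVariationOn (fun x => g (max (-1) (min 1 x))) univ := by
    refine ne_top_of_le_ne_top hg (eVariationOn.comp_le_of_monotoneOn g _ ?_ ?_)
    · intro x _ y _ hxy
      exact max_le_max le_rfl (min_le_min le_rfl hxy)
    · intro x _
      exact ⟨le_max_left _ _, max_le (by norm_num) (min_le_left _ _)⟩
  have h := bv_mul (bv_add (bv_step (brLeft b))
    (bv_smul (-1) (bv_step (brLeft b + 1 / 2)))) hcl
  convert h using 1
  ext x
  simp only [Pi.mul_apply, Pi.add_apply, Pi.smul_apply, smul_eq_mul]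
  by_cases hx : x ∈ brSet b
  · have hx' := brSet_subset b hx
    rw [indicator_of_mem hx, if_pos hx.1, if_neg (not_le.2 hx.2), min_eq_right hx'.2,
      max_eq_right hx'.1]
    simp
  · rw [indicator_of_notMem hx]
    rw [mem_brSet_iff, not_and_or, not_le, not_lt] at hx
    rcases hx with hx | hx
    · rw [if_neg (not_le.2 hx), if_neg (not_le.2 (by linarith))]
      simp
    · rw [if_pos (by linarith), if_pos hx]
      simp

theorem bv_pfFormula {κ : ℝ} {g : ℝ → ℂ} (hg : BoundedVariationOn g (Icc (-1) 1)) :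
    BoundedVariationOn (pfFormula κ g) (Icc (-1) 1) := by
  have hb : ∀ b, BoundedVariationOn
      (fun x => (brSet b).indicator g ((x - brConst κ b) / brSlope κ b)) univ := by
    intro b
    refine ne_top_of_le_ne_top (bv_indicator hg b) ?_
    rcases le_total 0 (brSlope κ b) with h | h
    · refine eVariationOn.comp_le_of_monotoneOn _ _ ?_ (fun _ _ => mem_univ _)
      intro x _ y _ hxy
      exact div_le_div_of_nonneg_right (by linarith) h
    · refine eVariationOn.comp_le_of_antitoneOn _ _ ?_ (fun _ _ => mem_univ _)
      intro x _ y _ hxy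
      exact div_le_div_of_nonpos_of_le h (by linarith)
  have hs : BoundedVariationOn (pfFormula κ g) univ := by
    have h := bv_add (bv_add (bv_add
      (bv_smul ((|brSlope κ 0|⁻¹ : ℝ) : ℂ) (hb 0)) (bv_smul ((|brSlope κ 1|⁻¹ : ℝ) : ℂ) (hb 1)))
      (bv_smul ((|brSlope κ 2|⁻¹ : ℝ) : ℂ) (hb 2))) (bv_smul ((|brSlope κ 3|⁻¹ : ℝ) : ℂ) (hb 3))
    convert h using 1
    ext x
    simp only [pfFormula, Fin.sum_univ_four, Pi.add_apply, Pi.smul_apply, smul_eq_mul]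
  exact hs.mono (subset_univ _)

theorem pfL1_mem_BV {κ : ℝ} (h0 : 0 ≤ κ) (h1 : κ ≤ 1) {f : Lp ℂ 1 leb} (hf : f ∈ BV) :
    pfL1 leb (tent κ) f ∈ BV := by
  obtain ⟨g, hg, hfg⟩ := hf
  exact ⟨pfFormula κ g, bv_pfFormula hg, pfL1_ae_eq h0 h1 f hfg⟩

/-- The Perron–Frobenius operator `P_n` of `T_{κ_n}`, acting on `BV`. -/
noncomputable def pf (n : ℕ) : Module.End ℂ BV where
  toFun f := ⟨pfL1 leb (tent (kappa n)) f,
    pfL1_mem_BV (kappa_pos n).le (kappa_le_one n) f.2⟩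
  map_add' f g := Subtype.ext (pfL1_add (kappa_pos n).le (kappa_le_one n) f g)
  map_smul' c f := Subtype.ext (pfL1_smul (kappa_pos n).le (kappa_le_one n) c f)

/-! ### Second-largest eigenvalue and mixing time

The spectrum of an endomorphism `L` of a complex vector space is the set of `z` for which `L - z`
is not bijective. For a bounded operator on a Banach space (in particular for `P_n` on `BV` with
the `BV` norm) this is the usual spectrum, by the bounded inverse theorem. -/

/-- `a` and `b` are the largest and the second-largest eigenvalue of `L` in modulus: both are
eigenvalues, `a` has algebraic multiplicity one, `|b| < |a|`, and every other point of the spectrum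
has modulus less than `|b|`. -/
structure IsTopTwo {V : Type*} [AddCommGroup V] [Module ℂ V] (L : Module.End ℂ V) (a b : ℂ) :
    Prop where
  fst : L.HasEigenvalue a
  simple : Module.finrank ℂ (L.maxGenEigenspace a) = 1
  snd : L.HasEigenvalue b
  lt : ‖b‖ < ‖a‖
  rest : ∀ z ∈ spectrum ℂ L, z ≠ a → z ≠ b → ‖z‖ < ‖b‖

/-- The mixing time (up to a scale factor) of an operator with simple leading eigenvalue `1`:
`1 / |log ρ|`, where `ρ` is the largest modulus of a point of the spectrum other than `1`. -/
noncomputable def mixingTime {V : Type*} [AddCommGroup V] [Module ℂ V] (L : Module.End ℂ V) : ℝ :=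
  1 / |Real.log (sSup (norm '' (spectrum ℂ L \ {1})))|

end PairedTent

/-! The map is odd and piecewise affine with slopes ±β, where β = 2(1 + κ). The equation β^n κ = 1
says that the orbit of -κ reaches 0 after n steps, which makes the partition Markov. Hence P_n
preserves the step functions on the cells and acts on them as M_n (`pf_stepBV`).

Modulo step functions P_n is small. For a family of functions, one on each closed cell, the sum of
the variations ignores additive constants on cells, and the transfer operator multiplies it by at
most 1/β (`totalVar_transfer_le`). So for |z| > 1/β the operator P_n - z is injective modulo step
functions (`mem_range_stepBV`, by iteration) and surjective modulo them (`exists_pf_eq`, by a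
Neumann series). By `IsTopTwo.of_quotient`, leading eigenvalues of M_n of modulus greater than 1/β
are then also those of P_n.

The matrix A_n commutes with reversal of the cells, so its eigenvectors split into even and odd ones
(ε = 1, -1). The n cells in [-1, -1/2] give an affine recurrence, whose closure forces w^n (w - 2) =
2ε for every eigenvalue w ≠ 0, 1 of parity ε (`IsAdjEigen.charpoly`); conversely each such root has
the explicit eigenvector `eigVec`. The even equation has the root β, the odd one a real root w in
(3/2, 2). Written as w = 2 + 2ε w^(-n), the equation is a fixed point problem for a contraction on
|w| ≥ 3/2, so there are no other roots there (`root_unique`). Thus the second eigenvalue is w/β, and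
it exceeds 1/β. The eigenvalue 1 has no Jordan block because M_n preserves the integral and its
fixed vector is positive (`markov_maxGenEigenspace_one`).

Put w = 2(1 - δ). Then 2^n κ (1 + κ)^n = 1 and 2^n δ (1 - δ)^n = 1, so κ and δ are both asymptotic
to 2^(-n). The expansion of the eigenvalue (1 - δ)/(1 + κ) and of its logarithm follows. -/

namespace PairedTent

/-! ### The slope `β_n = 2 (1 + κ_n)` and closed forms of the endpoints -/

/-- The modulus `β_n = 2 (1 + κ_n)` of the slope of `T_{κ_n}`. -/
noncomputable def beta (n : ℕ) : ℝ := 2 * (1 + kappa n)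

theorem two_lt_beta (n : ℕ) : 2 < beta n := by
  have := kappa_pos n
  unfold beta
  linarith

theorem beta_pos (n : ℕ) : 0 < beta n := by linarith [two_lt_beta n]

/-- This is the Markov condition: it amounts to T^n(-κ_n) = β^n κ_n - 1 = 0. -/
theorem beta_pow_mul_kappa (n : ℕ) : beta n ^ n * kappa n = 1 := by
  have := kappa_eq n
  rwa [show 2 + 2 * kappa n = beta n by unfold beta; ring] at this

theorem beta_pow_mul_kappa_lt {n i j : ℕ} (h : i < j) :
    beta n ^ i * kappa n < beta n ^ j * kappa n :=
  mul_lt_mul_of_pos_right (pow_lt_pow_right₀ (by linarith [two_lt_beta n]) h) (kappa_pos n)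

theorem beta_pow_pred_mul_kappa {n : ℕ} (hn : 1 ≤ n) :
    beta n * (beta n ^ (n - 1) * kappa n) = 1 := by
  rw [← mul_assoc, ← pow_succ', Nat.sub_add_cancel hn, beta_pow_mul_kappa]

theorem beta_pow_mul_kappa_lt_half {n i : ℕ} (h : i < n) : beta n ^ i * kappa n < 1 / 2 := by
  have h1 := beta_pow_pred_mul_kappa (n := n) (by omega)
  have h2 : beta n ^ i * kappa n ≤ beta n ^ (n - 1) * kappa n := by
    rcases (show i ≤ n - 1 by omega).eq_or_lt with rfl | h
    · exact le_rfl
    · exact (beta_pow_mul_kappa_lt h).le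
  have h3 := two_lt_beta n
  have h4 : 0 < beta n ^ (n - 1) * kappa n := mul_pos (pow_pos (beta_pos n) _) (kappa_pos n)
  nlinarith

/-! ### Odd symmetry, the orbit of -κ_n, and the ordering of the endpoints -/

theorem tent_neg (κ x : ℝ) : tent κ (-x) = -tent κ x := by
  unfold tent
  by_cases hx : x = 0
  · simp [hx]
  rw [if_neg hx, if_neg (neg_ne_zero.2 hx)]
  split_ifs <;> first
    | ring1
    | (exfalso; linarith)
    | (exfalso; exact hx (by linarith))
    | (have : x = 1 / 2 := by linarith
       subst this
       ring1)
    | (have : x = -1 / 2 := by linarith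
       subst this
       ring1)

theorem tent_iterate_neg (κ x : ℝ) (m : ℕ) : (tent κ)^[m] (-x) = -(tent κ)^[m] x := by
  induction m with
  | zero => rfl
  | succ m ih =>
    rw [Function.iterate_succ_apply', ih, tent_neg, ← Function.iterate_succ_apply' (tent κ)]

/-- After the first step the orbit stays in [-1, -1/2] until time n - 1, and there the map
multiplies the distance to -1 by β. -/
theorem tent_iterate_neg_kappa {n i : ℕ} (h1 : 1 ≤ i) (h2 : i < n) :
    (tent (kappa n))^[i] (-kappa n) = beta n ^ i * kappa n - 1 := by
  induction i, h1 using Nat.le_induction with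
  | base =>
    have h0 := kappa_pos n
    have h3 := kappa_lt_half (n := n) (by omega)
    rw [Function.iterate_one, tent, if_neg (by linarith), if_neg (by linarith),
      if_pos (by linarith), beta]
    ring
  | succ i h1 ih =>
    have h3 := beta_pow_mul_kappa_lt_half (n := n) (i := i) (by omega)
    have h4 : (0 : ℝ) < beta n ^ i * kappa n := mul_pos (pow_pos (beta_pos n) _) (kappa_pos n)
    rw [Function.iterate_succ_apply', ih (by omega), tent, if_neg (by linarith),
      if_pos (by linarith), pow_succ']
    unfold beta
    ring

theorem endpt_zero (n : ℕ) : endpt n 0 = -1 := by simp [endpt]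

theorem endpt_of_lt {n i : ℕ} (h1 : 1 ≤ i) (h2 : i < n) :
    endpt n i = beta n ^ i * kappa n - 1 := by
  rw [endpt, if_neg (by omega), if_pos h2, tent_iterate_neg_kappa h1 h2]

theorem endpt_n {n : ℕ} (hn : 1 ≤ n) : endpt n n = -1 / 2 := by
  rw [endpt, if_neg (by omega), if_neg (by omega), if_pos rfl]

theorem endpt_n_add_one (n : ℕ) : endpt n (n + 1) = -kappa n := by
  rw [endpt, if_neg (by omega), if_neg (by omega), if_neg (by omega), if_pos rfl]

theorem endpt_n_add_two (n : ℕ) : endpt n (n + 2) = 0 := by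
  rw [endpt, if_neg (by omega), if_neg (by omega), if_neg (by omega), if_neg (by omega),
    if_pos rfl]

theorem endpt_of_le {n i : ℕ} (hn : 1 ≤ n) (h : 2 * n + 4 ≤ i) : endpt n i = 1 := by
  rw [endpt, if_neg (by omega), if_neg (by omega), if_neg (by omega), if_neg (by omega),
    if_neg (by omega), if_neg (by omega), if_neg (by omega), if_neg (by omega)]

theorem endpt_symm_left {n i : ℕ} (hn : 1 ≤ n) (h : i ≤ n + 2) :
    endpt n (2 * n + 4 - i) = -endpt n i := by
  rcases Nat.eq_zero_or_pos i with rfl | h0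
  · rw [endpt_of_le hn (by omega), endpt_zero]
    norm_num
  rcases lt_or_ge i n with h1 | h1
  · rw [endpt_of_lt h0 h1, ← tent_iterate_neg_kappa h0 h1, endpt, if_neg (by omega),
      if_neg (by omega), if_neg (by omega), if_neg (by omega), if_neg (by omega),
      if_neg (by omega), if_neg (by omega), if_pos (by omega), tent_iterate_neg, neg_neg]
    congr 2
    omega
  rcases (show i = n ∨ i = n + 1 ∨ i = n + 2 by omega) with rfl | rfl | rfl
  · rw [endpt_n hn, show 2 * i + 4 - i = i + 4 by omega, endpt, if_neg (by omega),
      if_neg (by omega), if_neg (by omega), if_neg (by omega), if_neg (by omega),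
      if_neg (by omega), if_pos rfl]
    norm_num
  · rw [endpt_n_add_one, show 2 * n + 4 - (n + 1) = n + 3 by omega, endpt, if_neg (by omega),
      if_neg (by omega), if_neg (by omega), if_neg (by omega), if_neg (by omega), if_pos rfl,
      neg_neg]
  · rw [show 2 * n + 4 - (n + 2) = n + 2 by omega, endpt_n_add_two, neg_zero]

theorem endpt_symm {n i : ℕ} (hn : 1 ≤ n) (h : i ≤ 2 * n + 4) :
    endpt n (2 * n + 4 - i) = -endpt n i := by
  rcases le_total i (n + 2) with h1 | h1
  · exact endpt_symm_left hn h1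
  · have := endpt_symm_left (i := 2 * n + 4 - i) hn (by omega)
    rw [show 2 * n + 4 - (2 * n + 4 - i) = i by omega] at this
    rw [this, neg_neg]

theorem endpt_lt_succ_left {n i : ℕ} (hn : 1 ≤ n) (h : i < n + 2) :
    endpt n i < endpt n (i + 1) := by
  rcases lt_or_ge (i + 1) n with h1 | h1
  · rw [endpt_of_lt (i := i + 1) (by omega) h1]
    have hp : 0 < beta n ^ (i + 1) * kappa n := mul_pos (pow_pos (beta_pos n) _) (kappa_pos n)
    rcases Nat.eq_zero_or_pos i with rfl | h0
    · rw [endpt_zero]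
      linarith
    · rw [endpt_of_lt h0 (by omega)]
      linarith [beta_pow_mul_kappa_lt (n := n) (Nat.lt_add_one i)]
  rcases (show i + 1 = n ∨ i = n ∨ i = n + 1 by omega) with h2 | rfl | rfl
  · rw [h2, endpt_n hn]
    rcases Nat.eq_zero_or_pos i with rfl | h0
    · rw [endpt_zero]
      norm_num
    · rw [endpt_of_lt h0 (by omega)]
      linarith [beta_pow_mul_kappa_lt_half (n := n) (i := i) (by omega)]
  · rw [endpt_n hn, endpt_n_add_one]
    linarith [kappa_lt_half hn]
  · rw [endpt_n_add_one, endpt_n_add_two]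
    linarith [kappa_pos n]

theorem endpt_lt_succ {n i : ℕ} (hn : 1 ≤ n) (h : i < 2 * n + 4) :
    endpt n i < endpt n (i + 1) := by
  rcases lt_or_ge i (n + 2) with h1 | h1
  · exact endpt_lt_succ_left hn h1
  · have h2 := endpt_lt_succ_left (i := 2 * n + 4 - (i + 1)) hn (by omega)
    rw [show 2 * n + 4 - (i + 1) + 1 = 2 * n + 4 - i by omega, endpt_symm hn (by omega),
      endpt_symm hn (by omega)] at h2
    linarith

theorem endpt_mono {n : ℕ} (hn : 1 ≤ n) : Monotone (endpt n) := by
  refine monotone_nat_of_le_succ fun i => ?_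
  rcases lt_or_ge i (2 * n + 4) with h | h
  · exact (endpt_lt_succ hn h).le
  -- Indices past 2n + 4 all give the default value 1, so monotonicity holds on all of ℕ.
  · rw [endpt_of_le hn h, endpt_of_le hn (by omega)]

theorem endpt_mem_Icc {n : ℕ} (hn : 1 ≤ n) (i : ℕ) : endpt n i ∈ Icc (-1 : ℝ) 1 := by
  constructor
  · rw [← endpt_zero n]
    exact endpt_mono hn (Nat.zero_le i)
  · rw [← endpt_of_le hn (Nat.le_add_left (2 * n + 4) i)]
    exact endpt_mono hn (by omega)

/-! ### The image of a cell is the interval between two endpoints -/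

/-- Index of the left end of the image of the `j`-th cell, for the cells left of `0`. -/
def loLeft (n j : ℕ) : ℕ :=
  if j = 0 then 0 else if j + 1 < n then j + 1 else if j + 1 = n then n + 2
  else if j = n then 1 else 0

/-- Index of the right end of the image of the `j`-th cell, for the cells left of `0`. -/
def hiLeft (n j : ℕ) : ℕ :=
  if j = 0 then 2 else if j + 2 < n then j + 2 else if j + 2 = n then n + 2
  else if j ≤ n then n + 3 else 1

/-- Index of the left end of the image of the `j`-th cell. -/
def lo (n j : ℕ) : ℕ := if j < n + 2 then loLeft n j else 2 * n + 4 - hiLeft n (2 * n + 3 - j)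

/-- Index of the right end of the image of the `j`-th cell. -/
def hi (n j : ℕ) : ℕ := if j < n + 2 then hiLeft n j else 2 * n + 4 - loLeft n (2 * n + 3 - j)

/-- The branch containing the `j`-th cell. -/
def br (n j : ℕ) : Fin 4 := if j < n then 0 else if j < n + 2 then 1 else if j < n + 4 then 2 else 3

/-- The affine extension of the branch of `T_{κ_n}` on the `j`-th cell. -/
noncomputable def fwd (n j : ℕ) (y : ℝ) : ℝ :=
  brSlope (kappa n) (br n j) * y + brConst (kappa n) (br n j)

/-- The inverse of `fwd n j`. -/
noncomputable def bwd (n j : ℕ) (x : ℝ) : ℝ :=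
  (x - brConst (kappa n) (br n j)) / brSlope (kappa n) (br n j)

theorem fwd_bwd (n j : ℕ) (x : ℝ) : fwd n j (bwd n j x) = x := by
  have := brSlope_ne (kappa_pos n).le (br n j)
  unfold fwd bwd
  field_simp
  ring

theorem hiLeft_le {n j : ℕ} (hn : 6 ≤ n) : hiLeft n j ≤ 2 * n + 4 := by
  unfold hiLeft
  split_ifs <;> omega

theorem loLeft_lt_hiLeft {n j : ℕ} (hn : 6 ≤ n) (hj : j < n + 2) : loLeft n j < hiLeft n j := by
  unfold hiLeft loLeft
  split_ifs <;> omega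

theorem lo_lt_hi {n j : ℕ} (hn : 6 ≤ n) (hj : j < 2 * n + 4) : lo n j < hi n j := by
  unfold lo hi
  split_ifs with h
  · exact loLeft_lt_hiLeft hn h
  · have h1 := loLeft_lt_hiLeft (j := 2 * n + 3 - j) hn (by omega)
    have h2 := hiLeft_le (j := 2 * n + 3 - j) hn
    omega

theorem hi_le {n j : ℕ} (hn : 6 ≤ n) : hi n j ≤ 2 * n + 4 := by
  unfold hi
  split_ifs
  · exact hiLeft_le hn
  · omega

theorem lo_rev {n j : ℕ} (hn : 6 ≤ n) (hj : j < 2 * n + 4) :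
    lo n (2 * n + 3 - j) = 2 * n + 4 - hi n j := by
  rcases lt_or_ge j (n + 2) with h | h
  · rw [lo, hi, if_neg (by omega), if_pos h, show 2 * n + 3 - (2 * n + 3 - j) = j by omega]
  · have h2 := loLeft_lt_hiLeft (j := 2 * n + 3 - j) hn (by omega)
    have h3 := hiLeft_le (j := 2 * n + 3 - j) hn
    rw [lo, hi, if_pos (by omega), if_neg (by omega)]
    omega

theorem hi_rev {n j : ℕ} (hn : 6 ≤ n) (hj : j < 2 * n + 4) :
    hi n (2 * n + 3 - j) = 2 * n + 4 - lo n j := by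
  rcases lt_or_ge j (n + 2) with h | h
  · rw [lo, hi, if_neg (by omega), if_pos h, show 2 * n + 3 - (2 * n + 3 - j) = j by omega]
  · have h3 := hiLeft_le (j := 2 * n + 3 - j) hn
    rw [lo, hi, if_pos (by omega), if_neg (by omega)]
    omega

theorem br_rev {n j : ℕ} (hj : j < 2 * n + 4) :
    brSlope (kappa n) (br n (2 * n + 3 - j)) = brSlope (kappa n) (br n j) ∧
      brConst (kappa n) (br n (2 * n + 3 - j)) = -brConst (kappa n) (br n j) ∧
      brLeft (br n (2 * n + 3 - j)) = -(brLeft (br n j) + 1 / 2) := by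
  have key : ∀ b : Fin 4, brSlope (kappa n) (3 - b) = brSlope (kappa n) b ∧
      brConst (kappa n) (3 - b) = -brConst (kappa n) b ∧ brLeft (3 - b) = -(brLeft b + 1 / 2) := by
    intro b
    fin_cases b
    · refine ⟨rfl, ?_, ?_⟩
      · change 1 - 2 * (1 + kappa n) = -(2 * (1 + kappa n) - 1)
        ring
      · change (1 / 2 : ℝ) = -(-1 + 1 / 2)
        norm_num
    · refine ⟨rfl, ?_, ?_⟩
      · change (1 : ℝ) = -(-1)
        norm_num
      · change (0 : ℝ) = -(-1 / 2 + 1 / 2)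
        norm_num
    · refine ⟨rfl, rfl, ?_⟩
      change (-1 / 2 : ℝ) = -(0 + 1 / 2)
      norm_num
    · refine ⟨rfl, ?_, ?_⟩
      · change 2 * (1 + kappa n) - 1 = -(1 - 2 * (1 + kappa n))
        ring
      · change (-1 : ℝ) = -(1 / 2 + 1 / 2)
        norm_num
  have hb : br n (2 * n + 3 - j) = 3 - br n j := by
    unfold br
    split_ifs <;> first | rfl | omega
  rw [hb]
  exact key _

theorem fwd_rev {n j : ℕ} (hj : j < 2 * n + 4) (y : ℝ) :
    fwd n (2 * n + 3 - j) (-y) = -fwd n j y := by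
  obtain ⟨h1, h2, -⟩ := br_rev hj
  unfold fwd
  rw [h1, h2]
  ring

/-- The two ends of the `j`-th cell are mapped to the ends of its image, in the order given by the
sign of the slope. -/
def EndsTo (n j : ℕ) : Prop :=
  (brSlope (kappa n) (br n j) = beta n ∧ fwd n j (endpt n j) = endpt n (lo n j) ∧
    fwd n j (endpt n (j + 1)) = endpt n (hi n j)) ∨
  (brSlope (kappa n) (br n j) = -beta n ∧ fwd n j (endpt n j) = endpt n (hi n j) ∧
    fwd n j (endpt n (j + 1)) = endpt n (lo n j))

theorem endpt_n_add_three {n : ℕ} (hn : 1 ≤ n) : endpt n (n + 3) = kappa n := by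
  rw [show n + 3 = 2 * n + 4 - (n + 1) by omega, endpt_symm hn (by omega), endpt_n_add_one,
    neg_neg]

/-- On the leftmost branch the distance β^i κ to -1 becomes β^(i+1) κ, and i = n - 1 is sent to 0.
The remaining values come from T(-1/2) = β/2 - 1 = κ, T(-κ) = βκ - 1 and the left limit -1 at 0. -/
theorem endsTo_left {n j : ℕ} (hn : 6 ≤ n) (hj : j < n + 2) : EndsTo n j := by
  have hn1 : 1 ≤ n := by omega
  unfold EndsTo
  rw [lo, hi, if_pos hj, if_pos hj]
  rcases lt_or_ge j n with h | h
  · left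
    have hb : br n j = 0 := by rw [br, if_pos h]
    have hf : ∀ y, fwd n j y = beta n * (y + 1) - 1 := fun y => by
      rw [fwd, hb]
      simp only [brSlope, brConst, beta, Matrix.cons_val_zero]
      ring
    refine ⟨by rw [hb]; rfl, ?_, ?_⟩
    · rw [hf, loLeft]
      rcases Nat.eq_zero_or_pos j with rfl | h0
      · rw [if_pos rfl, endpt_zero]
        ring
      rw [if_neg (by omega), endpt_of_lt h0 h]
      rcases lt_or_ge (j + 1) n with h1 | h1
      · rw [if_pos h1, endpt_of_lt (by omega) h1]
        ring
      · rw [if_neg (by omega), if_pos (by omega), endpt_n_add_two]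
        have := beta_pow_pred_mul_kappa hn1
        rw [show n - 1 = j by omega] at this
        linear_combination this
    · rw [hf, hiLeft]
      rcases lt_or_ge (j + 1) n with h1 | h1
      · rw [endpt_of_lt (by omega) h1]
        rcases lt_or_ge (j + 2) n with h2 | h2
        · rcases Nat.eq_zero_or_pos j with rfl | h0
          · rw [if_pos rfl, endpt_of_lt (by omega) h2]
            ring
          · rw [if_neg (by omega), if_pos h2, endpt_of_lt (by omega) h2]
            ring
        · rw [if_neg (by omega), if_neg (by omega), if_pos (by omega), endpt_n_add_two]
          have := beta_pow_pred_mul_kappa hn1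
          rw [show n - 1 = j + 1 by omega] at this
          linear_combination this
      · rw [if_neg (by omega), if_neg (by omega), if_neg (by omega), if_pos (by omega),
          show j + 1 = n by omega, endpt_n hn1, endpt_n_add_three hn1, beta]
        ring
  · right
    have hb : br n j = 1 := by rw [br, if_neg (by omega), if_pos hj]
    have hf : ∀ y, fwd n j y = -beta n * y - 1 := fun y => by
      rw [fwd, hb]
      simp only [brSlope, brConst, beta, Matrix.cons_val_one, Matrix.cons_val_zero]
      ring
    refine ⟨by rw [hb]; rfl, ?_, ?_⟩
    · rw [hf, hiLeft]
      rcases (show j = n ∨ j = n + 1 by omega) with rfl | rfl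
      · rw [if_neg (by omega), if_neg (by omega), if_neg (by omega), if_pos le_rfl, endpt_n hn1,
          endpt_n_add_three hn1, beta]
        ring
      · rw [if_neg (by omega), if_neg (by omega), if_neg (by omega), if_neg (by omega),
          endpt_n_add_one, endpt_of_lt le_rfl (by omega)]
        ring
    · rw [hf, loLeft]
      rcases (show j = n ∨ j = n + 1 by omega) with rfl | rfl
      · rw [if_neg (by omega), if_neg (by omega), if_neg (by omega), if_pos rfl, endpt_n_add_one,
          endpt_of_lt le_rfl (by omega)]
        ring
      · rw [if_neg (by omega), if_neg (by omega), if_neg (by omega), if_neg (by omega),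
          show n + 1 + 1 = n + 2 from rfl, endpt_n_add_two, endpt_zero]
        ring

theorem endsTo {n j : ℕ} (hn : 6 ≤ n) (hj : j < 2 * n + 4) : EndsTo n j := by
  rcases lt_or_ge j (n + 2) with h | h
  · exact endsTo_left hn h
  have hn1 : 1 ≤ n := by omega
  -- The cells right of 0 are the mirror images of those on the left; reflection exchanges the two
  -- ends but keeps the slope.
  obtain ⟨k, hk, rfl⟩ : ∃ k, k < n + 2 ∧ j = 2 * n + 3 - k := ⟨2 * n + 3 - j, by omega, by omega⟩
  have hk' : k < 2 * n + 4 := by omega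
  have e1 : endpt n (2 * n + 3 - k) = -endpt n (k + 1) := by
    rw [← endpt_symm hn1 (by omega)]
    congr 1
    omega
  have e2 : endpt n (2 * n + 3 - k + 1) = -endpt n k := by
    rw [← endpt_symm hn1 (by omega)]
    congr 1
    omega
  have h3 := hi_le (j := k) hn
  have h4 := lo_lt_hi hn hk'
  unfold EndsTo
  rw [e1, e2, fwd_rev hk', fwd_rev hk', (br_rev hk').1, lo_rev hn hk', hi_rev hn hk',
    endpt_symm hn1 h3, endpt_symm hn1 (by omega)]
  rcases endsTo_left hn hk with ⟨a, b, c⟩ | ⟨a, b, c⟩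
  · exact Or.inl ⟨a, by rw [c], by rw [b]⟩
  · exact Or.inr ⟨a, by rw [c], by rw [b]⟩

theorem brLeft_le_endpt_left {n j : ℕ} (hn : 6 ≤ n) (hj : j < n + 2) :
    brLeft (br n j) ≤ endpt n j ∧ endpt n (j + 1) ≤ brLeft (br n j) + 1 / 2 := by
  have hn1 : 1 ≤ n := by omega
  rcases lt_or_ge j n with h | h
  · have hb : br n j = 0 := by rw [br, if_pos h]
    have hl : brLeft 0 = -1 := rfl
    rw [hb, hl]
    refine ⟨(endpt_mem_Icc hn1 j).1, ?_⟩
    have := endpt_mono hn1 (show j + 1 ≤ n from h)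
    rw [endpt_n hn1] at this
    linarith
  · have hb : br n j = 1 := by rw [br, if_neg (by omega), if_pos hj]
    have hl : brLeft 1 = -1 / 2 := rfl
    rw [hb, hl]
    have h1 := endpt_mono hn1 h
    have h2 := endpt_mono hn1 (show j + 1 ≤ n + 2 from hj)
    rw [endpt_n hn1] at h1
    rw [endpt_n_add_two] at h2
    exact ⟨h1, by linarith⟩

theorem brLeft_le_endpt {n j : ℕ} (hn : 6 ≤ n) (hj : j < 2 * n + 4) :
    brLeft (br n j) ≤ endpt n j ∧ endpt n (j + 1) ≤ brLeft (br n j) + 1 / 2 := by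
  rcases lt_or_ge j (n + 2) with h | h
  · exact brLeft_le_endpt_left hn h
  have hn1 : 1 ≤ n := by omega
  obtain ⟨k, hk, rfl⟩ : ∃ k, k < n + 2 ∧ j = 2 * n + 3 - k := ⟨2 * n + 3 - j, by omega, by omega⟩
  have e1 : endpt n (2 * n + 3 - k) = -endpt n (k + 1) := by
    rw [← endpt_symm hn1 (by omega)]
    congr 1
    omega
  have e2 : endpt n (2 * n + 3 - k + 1) = -endpt n k := by
    rw [← endpt_symm hn1 (by omega)]
    congr 1
    omega
  obtain ⟨a, b⟩ := brLeft_le_endpt_left hn hk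
  rw [(br_rev (by omega)).2.2, e1, e2]
  constructor <;> linarith

theorem bwd_mem_Ioo {n j : ℕ} (hn : 6 ≤ n) (hj : j < 2 * n + 4) {x : ℝ} :
    bwd n j x ∈ Ioo (endpt n j) (endpt n (j + 1)) ↔
      x ∈ Ioo (endpt n (lo n j)) (endpt n (hi n j)) := by
  have hb := beta_pos n
  have hx := fwd_bwd n j x
  set y := bwd n j x
  unfold fwd at hx
  rcases endsTo hn hj with ⟨a, b, c⟩ | ⟨a, b, c⟩ <;> rw [← b, ← c, ← hx] <;> unfold fwd <;>
    rw [a] <;> simp only [mem_Ioo]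
  · constructor
    · rintro ⟨h1, h2⟩
      constructor <;> nlinarith
    · rintro ⟨h1, h2⟩
      constructor <;> nlinarith
  · constructor
    · rintro ⟨h1, h2⟩
      constructor <;> nlinarith
    · rintro ⟨h1, h2⟩
      constructor <;> nlinarith

/-- The closed version is needed because the pieces of `glue` live on half-open cells, which contain
an endpoint. -/
theorem bwd_mem_Icc {n j : ℕ} (hn : 6 ≤ n) (hj : j < 2 * n + 4) {x : ℝ} :
    bwd n j x ∈ Icc (endpt n j) (endpt n (j + 1)) ↔
      x ∈ Icc (endpt n (lo n j)) (endpt n (hi n j)) := by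
  have hb := beta_pos n
  have hx := fwd_bwd n j x
  set y := bwd n j x
  unfold fwd at hx
  rcases endsTo hn hj with ⟨a, b, c⟩ | ⟨a, b, c⟩ <;> rw [← b, ← c, ← hx] <;> unfold fwd <;>
    rw [a] <;> simp only [mem_Icc]
  · constructor
    · rintro ⟨h1, h2⟩
      constructor <;> nlinarith
    · rintro ⟨h1, h2⟩
      constructor <;> nlinarith
  · constructor
    · rintro ⟨h1, h2⟩
      constructor <;> nlinarith
    · rintro ⟨h1, h2⟩
      constructor <;> nlinarith

/-- Lengths are stretched by β; this is what makes M_n preserve the integral. -/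
theorem endpt_hi_sub_lo {n j : ℕ} (hn : 6 ≤ n) (hj : j < 2 * n + 4) :
    endpt n (hi n j) - endpt n (lo n j) = beta n * (endpt n (j + 1) - endpt n j) := by
  rcases endsTo hn hj with ⟨a, b, c⟩ | ⟨a, b, c⟩ <;> rw [← b, ← c] <;> unfold fwd <;> rw [a] <;>
    ring

theorem abs_brSlope (n : ℕ) (b : Fin 4) : |brSlope (kappa n) b| = beta n := by
  have h : brSlope (kappa n) b = beta n ∨ brSlope (kappa n) b = -beta n := by
    fin_cases b
    · exact Or.inl rfl
    · exact Or.inr rfl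
    · exact Or.inr rfl
    · exact Or.inl rfl
  rcases h with h | h <;> rw [h]
  · exact abs_of_pos (beta_pos n)
  · rw [abs_neg, abs_of_pos (beta_pos n)]

theorem mem_brSet_of_mem_cell {n j : ℕ} (hn : 6 ≤ n) (hj : j < 2 * n + 4) {y : ℝ}
    (hy : y ∈ Ico (endpt n j) (endpt n (j + 1))) : y ∈ brSet (br n j) := by
  obtain ⟨h1, h2⟩ := brLeft_le_endpt hn hj
  exact ⟨h1.trans hy.1, hy.2.trans_le h2⟩

/-- The affine formulas for the branches fail at 0, which is an endpoint of the partition and hence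
in no open cell. -/
theorem cell_ne_zero {n j : ℕ} (hn : 6 ≤ n) {y : ℝ}
    (hy : y ∈ Ioo (endpt n j) (endpt n (j + 1))) : y ≠ 0 := by
  have hn1 : 1 ≤ n := by omega
  rintro rfl
  rcases lt_or_ge j (n + 2) with h | h
  · have := endpt_mono hn1 (show j + 1 ≤ n + 2 from h)
    rw [endpt_n_add_two] at this
    linarith [hy.2]
  · have := endpt_mono hn1 h
    rw [endpt_n_add_two] at this
    linarith [hy.1]

theorem tent_image_cell {n : ℕ} (hn : 6 ≤ n) (j : Fin (2 * n + 4)) :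
    tent (kappa n) '' cell n j = Ioo (endpt n (lo n j)) (endpt n (hi n j)) := by
  have key : ∀ y ∈ cell n j, tent (kappa n) y = fwd n j y := fun y hy =>
    tent_eq _ (mem_brSet_of_mem_cell hn j.2 ⟨hy.1.le, hy.2⟩) (cell_ne_zero hn hy)
  ext x
  constructor
  · rintro ⟨y, hy, rfl⟩
    rw [key y hy, ← bwd_mem_Ioo hn j.2]
    have : bwd n j (fwd n j y) = y := by
      have := brSlope_ne (kappa_pos n).le (br n j)
      unfold bwd fwd
      field_simp
      ring
    rwa [this]
  · intro hx
    have hy := (bwd_mem_Ioo hn j.2).2 hx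
    exact ⟨bwd n j x, hy, by rw [key _ hy, fwd_bwd]⟩

theorem adjMatrix_apply {n : ℕ} (hn : 6 ≤ n) (i j : Fin (2 * n + 4)) :
    adjMatrix n i j = if lo n j ≤ i ∧ (i : ℕ) < hi n j then 1 else 0 := by
  have hn1 : 1 ≤ n := by omega
  have hiff : cell n i ⊆ tent (kappa n) '' cell n j ↔ lo n j ≤ i ∧ (i : ℕ) < hi n j := by
    rw [tent_image_cell hn]
    constructor
    · intro h
      obtain ⟨x, hx⟩ := nonempty_Ioo.2 (endpt_lt_succ hn1 i.2)
      have hx' := h hx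
      constructor
      · by_contra hc
        exact absurd (hx'.1.trans hx.2) (not_lt.2 (endpt_mono hn1 (by omega)))
      · by_contra hc
        exact absurd (hx.1.trans hx'.2) (not_lt.2 (endpt_mono hn1 (by omega)))
    · rintro ⟨h1, h2⟩
      exact Ioo_subset_Ioo (endpt_mono hn1 h1) (endpt_mono hn1 h2)
  simp only [adjMatrix, Matrix.of_apply, hiff]

/-! ### The action of `A_n` on vectors -/

/-- The action of `A_n` on vectors indexed by natural numbers. -/
noncomputable def adjAction (n : ℕ) (V : ℕ → ℂ) (i : ℕ) : ℂ :=
  ∑ j ∈ Finset.range (2 * n + 4), if lo n j ≤ i ∧ i < hi n j then V j else 0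

theorem adjAction_eq_sum {n i : ℕ} (V : ℕ → ℂ) (s : Finset ℕ)
    (h : ∀ j, (j < 2 * n + 4 ∧ lo n j ≤ i ∧ i < hi n j) ↔ j ∈ s) :
    adjAction n V i = ∑ j ∈ s, V j := by
  rw [adjAction, ← Finset.sum_filter]
  refine Finset.sum_congr ?_ fun _ _ => rfl
  ext j
  rw [Finset.mem_filter, Finset.mem_range, h]

theorem adjAction_zero {n : ℕ} (hn : 6 ≤ n) (V : ℕ → ℂ) :
    adjAction n V 0 = V 0 + V (n + 1) := by
  rw [adjAction_eq_sum V {0, n + 1}, Finset.sum_pair (by omega)]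
  intro j
  simp only [Finset.mem_insert, Finset.mem_singleton]
  grind [lo, hi, loLeft, hiLeft]

theorem adjAction_of_lt {n i : ℕ} (hn : 6 ≤ n) (h1 : 1 ≤ i) (h2 : i < n) (V : ℕ → ℂ) :
    adjAction n V i = V (i - 1) + V n := by
  rw [adjAction_eq_sum V {i - 1, n}, Finset.sum_pair (by omega)]
  intro j
  simp only [Finset.mem_insert, Finset.mem_singleton]
  grind [lo, hi, loLeft, hiLeft]

theorem adjAction_n {n : ℕ} (hn : 6 ≤ n) (V : ℕ → ℂ) :
    adjAction n V n = V (n - 2) + V n := by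
  rw [adjAction_eq_sum V {n - 2, n}, Finset.sum_pair (by omega)]
  intro j
  simp only [Finset.mem_insert, Finset.mem_singleton]
  grind [lo, hi, loLeft, hiLeft]

theorem adjAction_n_add_one {n : ℕ} (hn : 6 ≤ n) (V : ℕ → ℂ) :
    adjAction n V (n + 1) = V (n - 2) + V n + V (n + 3) + V (n + 4) := by
  rw [adjAction_eq_sum V {n - 2, n, n + 3, n + 4}]
  · rw [Finset.sum_insert, Finset.sum_insert, Finset.sum_pair (by omega)]
    · ring
    all_goals
      simp only [Finset.mem_insert, Finset.mem_singleton]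
      omega
  intro j
  simp only [Finset.mem_insert, Finset.mem_singleton]
  rcases lt_or_ge j (n + 2) with h | h <;> grind (splits := 20) [lo, hi, loLeft, hiLeft]

/-- Oddness of the map: A_n commutes with reversal of the cells, so eigenvectors can be split by
parity. -/
theorem adjAction_rev {n i : ℕ} (hn : 6 ≤ n) (hi' : i < 2 * n + 4) (V : ℕ → ℂ) :
    adjAction n (fun j => V (2 * n + 3 - j)) i = adjAction n V (2 * n + 3 - i) := by
  unfold adjAction
  rw [← Finset.sum_range_reflect]
  refine Finset.sum_congr rfl fun j hj => ?_
  rw [Finset.mem_range] at hj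
  rw [show 2 * n + 4 - 1 - j = 2 * n + 3 - j by omega, lo_rev hn hj, hi_rev hn hj]
  simp only [show 2 * n + 3 - (2 * n + 3 - j) = j by omega]
  have h1 := hi_le (j := j) hn
  have h2 := lo_lt_hi hn hj
  refine if_congr ?_ rfl rfl
  omega

theorem adjAction_congr {n : ℕ} {V W : ℕ → ℂ} (h : ∀ j < 2 * n + 4, V j = W j) (i : ℕ) :
    adjAction n V i = adjAction n W i :=
  Finset.sum_congr rfl fun j hj => by rw [h j (Finset.mem_range.1 hj)]

theorem adjAction_smul (n : ℕ) (c : ℂ) (V : ℕ → ℂ) (i : ℕ) :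
    adjAction n (fun j => c * V j) i = c * adjAction n V i := by
  unfold adjAction
  rw [Finset.mul_sum]
  exact Finset.sum_congr rfl fun j _ => by split_ifs <;> ring

theorem adjAction_add (n : ℕ) (V W : ℕ → ℂ) (i : ℕ) :
    adjAction n (fun j => V j + W j) i = adjAction n V i + adjAction n W i := by
  unfold adjAction
  rw [← Finset.sum_add_distrib]
  exact Finset.sum_congr rfl fun j _ => by split_ifs <;> ring

/-- `V` is an eigenvector of `A_n` for `w` (or zero). -/
def IsAdjEigen (n : ℕ) (w : ℂ) (V : ℕ → ℂ) : Prop :=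
  ∀ i < 2 * n + 4, adjAction n V i = w * V i

/-- `V` is even (`ε = 1`) or odd (`ε = -1`) under reversal of the cells. -/
def HasParity (n : ℕ) (ε : ℂ) (V : ℕ → ℂ) : Prop :=
  ∀ i < 2 * n + 4, V (2 * n + 3 - i) = ε * V i

theorem IsAdjEigen.add {n : ℕ} {w : ℂ} {V W : ℕ → ℂ} (hV : IsAdjEigen n w V)
    (hW : IsAdjEigen n w W) (c : ℂ) : IsAdjEigen n w (fun j => V j + c * W j) := fun i hi => by
  rw [adjAction_add, adjAction_smul, hV i hi, hW i hi]
  ring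

theorem IsAdjEigen.rev {n : ℕ} (hn : 6 ≤ n) {w : ℂ} {V : ℕ → ℂ} (hV : IsAdjEigen n w V) :
    IsAdjEigen n w (fun j => V (2 * n + 3 - j)) := fun i hi => by
  rw [adjAction_rev hn hi, hV _ (by omega)]

/-- Cells n - 1 and n have the same preimages, which gives the first equality. On the first n cells
the eigenvalue equation is w V_i = V_(i-1) + V_n; its fixed point is V_n / (w - 1), and the
deviation from it is divided by w at each step. Parity enters only through the row n + 1, where
cells n + 3 and n + 4 mirror n and n - 1. -/
theorem IsAdjEigen.left_values {n : ℕ} (hn : 6 ≤ n) {w ε : ℂ} {V : ℕ → ℂ}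
    (hV : IsAdjEigen n w V) (hp : HasParity n ε V) (h0 : w ≠ 0) :
    V (n - 1) = V n ∧ V (n + 1) = (w - 1) * V 0 ∧ w * (w - 1) * V 0 = (w + 2 * ε) * V n ∧
      ∀ i < n, w ^ i * ((w - 1) * V i - V n) = (w - 1) * V 0 - V n := by
  have e0 := hV 0 (by omega)
  have e1 : ∀ i, 1 ≤ i → i < n → V (i - 1) + V n = w * V i := fun i h1 h2 => by
    rw [← hV i (by omega), adjAction_of_lt hn h1 h2]
  have e2 := hV n (by omega)
  have e3 := hV (n + 1) (by omega)
  rw [adjAction_zero hn] at e0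
  rw [adjAction_n hn] at e2
  rw [adjAction_n_add_one hn] at e3
  have e4 := hp n (by omega)
  have e5 := hp (n - 1) (by omega)
  rw [show 2 * n + 3 - n = n + 3 by omega] at e4
  rw [show 2 * n + 3 - (n - 1) = n + 4 by omega] at e5
  have e6 := e1 (n - 1) (by omega) (by omega)
  rw [show n - 1 - 1 = n - 2 by omega] at e6
  have e7 : V (n - 1) = V n := mul_left_cancel₀ h0 (by rw [← e6, e2])
  refine ⟨e7, by linear_combination e0, ?_, ?_⟩
  · rw [e4, e5, e7] at e3
    linear_combination -w * e0 - e3 + e2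
  · intro i
    induction i with
    | zero => intro _; ring
    | succ i ih =>
      intro hi
      have h := e1 (i + 1) (by omega) hi
      rw [Nat.add_sub_cancel] at h
      rw [← ih (by omega), pow_succ]
      linear_combination -w ^ i * (w - 1) * h

/-- The recurrence at i = n - 1 must return the value V_n; eliminating V_0 leaves this equation. -/
theorem IsAdjEigen.charpoly {n : ℕ} (hn : 6 ≤ n) {w ε : ℂ} {V : ℕ → ℂ}
    (hV : IsAdjEigen n w V) (hp : HasParity n ε V) (h0 : w ≠ 0) :
    V n * (w ^ n * (w - 2) - 2 * ε) = 0 := by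
  obtain ⟨h1, -, h3, h4⟩ := hV.left_values hn hp h0
  have h5 := h4 (n - 1) (by omega)
  rw [h1] at h5
  have h6 : w ^ n = w * w ^ (n - 1) := by rw [← pow_succ', Nat.sub_add_cancel (by omega)]
  rw [h6]
  linear_combination w * h5 + h3

/-- An eigenvector of given parity is determined by its entry at n. Hence V_n = 0 is excluded for
true eigenvectors, and each such eigenspace is at most a line. -/
theorem IsAdjEigen.eq_zero {n : ℕ} (hn : 6 ≤ n) {w ε : ℂ} {V : ℕ → ℂ}
    (hV : IsAdjEigen n w V) (hp : HasParity n ε V) (h0 : w ≠ 0) (h1 : w ≠ 1) (hz : V n = 0) :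
    ∀ i < 2 * n + 4, V i = 0 := by
  obtain ⟨-, h2, h3, h4⟩ := hV.left_values hn hp h0
  have h1' : w - 1 ≠ 0 := sub_ne_zero.2 h1
  rw [hz, mul_zero] at h3
  have hV0 : V 0 = 0 := (mul_eq_zero.1 h3).resolve_left (mul_ne_zero h0 h1')
  have hl : ∀ i < n + 2, V i = 0 := by
    intro i hi
    rcases lt_or_ge i n with h | h
    · have := h4 i h
      rw [hz, hV0, mul_zero, sub_zero, sub_zero] at this
      exact (mul_eq_zero.1 ((mul_eq_zero.1 this).resolve_left (pow_ne_zero _ h0))).resolve_left h1'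
    rcases (show i = n ∨ i = n + 1 by omega) with rfl | rfl
    · exact hz
    · rw [h2, hV0, mul_zero]
  intro i hi
  rcases lt_or_ge i (n + 2) with h | h
  · exact hl i h
  · have := hp (2 * n + 3 - i) (by omega)
    rw [show 2 * n + 3 - (2 * n + 3 - i) = i by omega] at this
    rw [this, hl _ (by omega), mul_zero]

/-! ### Explicit eigenvectors -/

/-- The left half of the eigenvector of `A_n` of parity `ε` for `w`. -/
noncomputable def eigLeft (n : ℕ) (w ε : ℂ) (i : ℕ) : ℂ :=
  if i < n then 1 + 2 * ε / w ^ (i + 1) else if i = n then w - 1 else (w - 1) * (1 + 2 * ε / w)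

/-- The eigenvector of `A_n` of parity `ε` for `w`. -/
noncomputable def eigVec (n : ℕ) (w ε : ℂ) (i : ℕ) : ℂ :=
  if i < n + 2 then eigLeft n w ε i else ε * eigLeft n w ε (2 * n + 3 - i)

theorem eigVec_parity (n : ℕ) (w : ℂ) {ε : ℂ} (hε : ε * ε = 1) : HasParity n ε (eigVec n w ε) := by
  intro i hi
  unfold eigVec
  rcases lt_or_ge i (n + 2) with h | h
  · rw [if_neg (by omega), if_pos h, show 2 * n + 3 - (2 * n + 3 - i) = i by omega]
  · rw [if_pos (by omega), if_neg (by omega), ← mul_assoc, hε, one_mul]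

theorem eigVec_n (n : ℕ) (w ε : ℂ) : eigVec n w ε n = w - 1 := by
  rw [eigVec, if_pos (by omega), eigLeft, if_neg (by omega), if_pos rfl]

theorem eigVec_of_lt {n i : ℕ} (hi : i < n) (w ε : ℂ) :
    eigVec n w ε i = 1 + 2 * ε / w ^ (i + 1) := by
  rw [eigVec, if_pos (by omega), eigLeft, if_pos hi]

theorem eigVec_n_add_one (n : ℕ) (w ε : ℂ) :
    eigVec n w ε (n + 1) = (w - 1) * (1 + 2 * ε / w) := by
  rw [eigVec, if_pos (by omega), eigLeft, if_neg (by omega), if_neg (by omega)]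

theorem eigVec_isAdjEigen {n : ℕ} (hn : 6 ≤ n) {w ε : ℂ} (h0 : w ≠ 0) (hε : ε * ε = 1)
    (hw : w ^ n * (w - 2) = 2 * ε) : IsAdjEigen n w (eigVec n w ε) := by
  -- The characteristic equation is exactly the matching of the geometric values at index n - 1 with
  -- the value w - 1 at n. The normalization V_n = w - 1 makes the fixed point of the recurrence
  -- equal to 1.
  have hlast : 1 + 2 * ε / w ^ n = w - 1 := by
    rw [← hw, mul_div_cancel_left₀ _ (pow_ne_zero _ h0)]
    ring
  have hl : eigVec n w ε (n - 1) = w - 1 := by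
    rw [eigVec_of_lt (by omega), Nat.sub_add_cancel (by omega), hlast]
  have hl2 : eigVec n w ε (n - 2) + (w - 1) = w * (w - 1) := by
    rw [eigVec_of_lt (by omega), show n - 2 + 1 = n - 1 by omega]
    have : 2 * ε / w ^ (n - 1) = w * (2 * ε / w ^ n) := by
      rw [show n = n - 1 + 1 by omega, Nat.add_sub_cancel, pow_succ]
      field_simp
    rw [this]
    linear_combination w * hlast
  have hpar := eigVec_parity n w hε
  have hleft : ∀ i < n + 2, adjAction n (eigVec n w ε) i = w * eigVec n w ε i := by
    intro i hi
    rcases Nat.eq_zero_or_pos i with rfl | h1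
    · rw [adjAction_zero hn, eigVec_of_lt (by omega), eigVec_n_add_one, zero_add, pow_one]
      ring
    rcases lt_or_ge i n with h2 | h2
    · rw [adjAction_of_lt hn h1 h2, eigVec_of_lt (by omega), eigVec_of_lt h2, eigVec_n,
        Nat.sub_add_cancel h1, pow_succ]
      field_simp
      ring
    rcases (show i = n ∨ i = n + 1 by omega) with rfl | rfl
    · rw [adjAction_n hn, eigVec_n, hl2]
    · rw [adjAction_n_add_one hn, eigVec_n, hl2, eigVec_n_add_one]
      have e4 := hpar n (by omega)
      have e5 := hpar (n - 1) (by omega)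
      rw [show 2 * n + 3 - n = n + 3 by omega, eigVec_n] at e4
      rw [show 2 * n + 3 - (n - 1) = n + 4 by omega, hl] at e5
      rw [e4, e5]
      field_simp
      ring
  intro i hi
  rcases lt_or_ge i (n + 2) with h | h
  · exact hleft i h
  have h3 := hleft (2 * n + 3 - i) (by omega)
  rw [← adjAction_rev hn hi, hpar i hi] at h3
  have h4 : adjAction n (fun j => eigVec n w ε (2 * n + 3 - j)) i =
      ε * adjAction n (eigVec n w ε) i := by
    rw [← adjAction_smul]
    exact adjAction_congr (fun j hj => hpar j hj) i
  rw [h4] at h3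
  -- Multiplication by ε cancels the sign produced by reversal, as ε² = 1.
  linear_combination ε * h3 + (w * eigVec n w ε i - adjAction n (eigVec n w ε) i) * hε

/-! ### Roots of the characteristic equations `w ^ n (w - 2) = ±2` -/

theorem beta_root (n : ℕ) : (beta n : ℂ) ^ n * (beta n - 2) = 2 * 1 := by
  have := beta_pow_mul_kappa n
  have h : beta n ^ n * (beta n - 2) = 2 * 1 := by
    rw [show beta n - 2 = 2 * kappa n by unfold beta; ring]
    linear_combination 2 * this
  exact_mod_cast h

theorem exists_subdominant_root {n : ℕ} (hn : 6 ≤ n) :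
    ∃ w : ℝ, 3 / 2 < w ∧ w < 2 ∧ w ^ n * (2 - w) = 2 := by
  have hc : ContinuousOn (fun w : ℝ => w ^ n * (2 - w)) (Icc (3 / 2) 2) := by fun_prop
  -- At 3/2 the function is at least (3/2)^6 / 2 > 2, and at 2 it vanishes.
  have h1 : (2 : ℝ) < (3 / 2) ^ n * (2 - 3 / 2) := by
    have : ((3 : ℝ) / 2) ^ 6 ≤ (3 / 2) ^ n := pow_le_pow_right₀ (by norm_num) hn
    norm_num at this ⊢
    linarith
  obtain ⟨w, hw, h⟩ := intermediate_value_Icc' (by norm_num) hc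
    (show (2 : ℝ) ∈ Icc _ _ from ⟨by norm_num, h1.le⟩)
  refine ⟨w, lt_of_le_of_ne hw.1 ?_, lt_of_le_of_ne hw.2 ?_, h⟩
  · rintro rfl
    exact h1.ne' h
  · rintro rfl
    norm_num at h

theorem norm_pow_sub_pow_le {a b : ℂ} {r : ℝ} (ha : ‖a‖ ≤ r) (hb : ‖b‖ ≤ r) (n : ℕ) :
    ‖a ^ (n + 1) - b ^ (n + 1)‖ ≤ (n + 1) * r ^ n * ‖a - b‖ := by
  induction n with
  | zero => simp
  | succ n ih =>
    have hr : 0 ≤ r := (norm_nonneg a).trans ha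
    calc ‖a ^ (n + 1 + 1) - b ^ (n + 1 + 1)‖
        = ‖a * (a ^ (n + 1) - b ^ (n + 1)) + (a - b) * b ^ (n + 1)‖ := by ring_nf
      _ ≤ ‖a‖ * ‖a ^ (n + 1) - b ^ (n + 1)‖ + ‖a - b‖ * ‖b‖ ^ (n + 1) := by
          rw [← norm_pow, ← norm_mul, ← norm_mul]
          exact norm_add_le _ _
      _ ≤ r * ((n + 1) * r ^ n * ‖a - b‖) + ‖a - b‖ * r ^ (n + 1) := by gcongr
      _ = _ := by
          push_cast
          ring

theorem two_mul_lt_pow {n : ℕ} (hn : 6 ≤ n) : 2 * (n : ℝ) < (3 / 2) ^ (n + 1) := by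
  induction n, hn using Nat.le_induction with
  | base => norm_num
  | succ n hn ih =>
    have : (6 : ℝ) ≤ n := by exact_mod_cast hn
    rw [pow_succ]
    push_cast
    linarith

/-- Both numbers are fixed points of w ↦ 2 + 2ε w^(-n). Each of the n factors 1/w is bounded by 2/3
and inversion has Lipschitz constant (2/3)², so the total constant is 2n (2/3)^(n+1) < 1. -/
theorem root_unique {n : ℕ} (hn : 6 ≤ n) {w w' ε : ℂ} (hε : ‖ε‖ = 1) (h1 : 3 / 2 ≤ ‖w‖)
    (h2 : 3 / 2 ≤ ‖w'‖) (h3 : w ^ n * (w - 2) = 2 * ε) (h4 : w' ^ n * (w' - 2) = 2 * ε) :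
    w = w' := by
  have hw : w ≠ 0 := norm_pos_iff.1 (by linarith)
  have hw' : w' ≠ 0 := norm_pos_iff.1 (by linarith)
  have h5 : w - w' = 2 * ε * (w⁻¹ ^ n - w'⁻¹ ^ n) := by
    have e1 : w - 2 = 2 * ε * w⁻¹ ^ n := by
      rw [← h3, inv_pow]
      field_simp
    have e2 : w' - 2 = 2 * ε * w'⁻¹ ^ n := by
      rw [← h4, inv_pow]
      field_simp
    linear_combination e1 - e2
  have ha : ‖w⁻¹‖ ≤ (3 / 2 : ℝ)⁻¹ := by
    rw [norm_inv]
    exact inv_anti₀ (by norm_num) h1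
  have hb : ‖w'⁻¹‖ ≤ (3 / 2 : ℝ)⁻¹ := by
    rw [norm_inv]
    exact inv_anti₀ (by norm_num) h2
  have h6 : ‖w⁻¹ - w'⁻¹‖ ≤ (3 / 2 : ℝ)⁻¹ * (3 / 2 : ℝ)⁻¹ * ‖w - w'‖ := by
    rw [show w⁻¹ - w'⁻¹ = w⁻¹ * w'⁻¹ * (w' - w) by field_simp, norm_mul, norm_mul,
      norm_sub_rev w']
    gcongr
  have h7 := norm_pow_sub_pow_le ha hb (n - 1)
  rw [Nat.sub_add_cancel (by omega), Nat.cast_sub (by omega)] at h7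
  have h8 : ‖w - w'‖ ≤ 2 * n * ((3 / 2 : ℝ) ^ (n + 1))⁻¹ * ‖w - w'‖ := by
    calc ‖w - w'‖ = 2 * ‖w⁻¹ ^ n - w'⁻¹ ^ n‖ := by
          conv_lhs => rw [h5, norm_mul, norm_mul, hε]
          norm_num
      _ ≤ 2 * (n * (3 / 2 : ℝ)⁻¹ ^ (n - 1) * ((3 / 2 : ℝ)⁻¹ * (3 / 2 : ℝ)⁻¹ * ‖w - w'‖)) := by
          push_cast at h7
          rw [sub_add_cancel] at h7
          gcongr
          exact h7.trans (by gcongr)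
      _ = _ := by
          rw [← inv_pow, show n + 1 = n - 1 + 2 by omega, pow_add]
          ring
  have h9 : 2 * n * ((3 / 2 : ℝ) ^ (n + 1))⁻¹ < 1 := by
    rw [← div_eq_mul_inv, div_lt_one (by positivity)]
    exact two_mul_lt_pow hn
  by_contra hne
  have : 0 < ‖w - w'‖ := norm_pos_iff.2 (sub_ne_zero.2 hne)
  nlinarith

/-! ### The spectrum of `M_n` -/

/-- Extension by zero of a vector to all natural numbers. -/
noncomputable def extVec {N : ℕ} (v : Fin N → ℂ) (i : ℕ) : ℂ := if h : i < N then v ⟨i, h⟩ else 0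

theorem extVec_coe {N : ℕ} (v : Fin N → ℂ) (i : Fin N) : extVec v i = v i := by
  rw [extVec, dif_pos i.2]

/-- `M_n` as an endomorphism. -/
noncomputable def markovEnd (n : ℕ) : Module.End ℂ (Fin (2 * n + 4) → ℂ) :=
  Matrix.toLin' (markovMatrix n)

theorem markovEnd_apply {n : ℕ} (hn : 6 ≤ n) (v : Fin (2 * n + 4) → ℂ) (i : Fin (2 * n + 4)) :
    markovEnd n v i = (beta n : ℂ)⁻¹ * adjAction n (extVec v) i := by
  rw [markovEnd, Matrix.toLin'_apply, markovMatrix, Matrix.smul_mulVec, Pi.smul_apply, smul_eq_mul]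
  congr 1
  rw [Matrix.mulVec, dotProduct, adjAction, ← Fin.sum_univ_eq_sum_range
    (fun j => if lo n j ≤ i ∧ i < hi n j then extVec v j else 0)]
  refine Finset.sum_congr rfl fun j _ => ?_
  rw [adjMatrix_apply hn, extVec_coe]
  split_ifs <;> simp

theorem markov_eigen_iff {n : ℕ} (hn : 6 ≤ n) (v : Fin (2 * n + 4) → ℂ) (z : ℂ) :
    markovEnd n v = z • v ↔ IsAdjEigen n (z * beta n) (extVec v) := by
  have hb : (beta n : ℂ) ≠ 0 := by exact_mod_cast (beta_pos n).ne'
  constructor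
  · intro h i hi
    have := congrFun h ⟨i, hi⟩
    rw [markovEnd_apply hn, Pi.smul_apply, ← extVec_coe v, smul_eq_mul] at this
    rw [mul_right_comm, ← this]
    field_simp
  · intro h
    ext i
    rw [markovEnd_apply hn, h i i.2, Pi.smul_apply, extVec_coe, smul_eq_mul]
    field_simp

theorem IsAdjEigen.congr {n : ℕ} {w : ℂ} {V W : ℕ → ℂ} (h : ∀ j < 2 * n + 4, V j = W j)
    (hV : IsAdjEigen n w V) : IsAdjEigen n w W := fun i hi => by
  rw [← adjAction_congr h i, hV i hi, h i hi]

theorem markov_hasEigenvector {n : ℕ} (hn : 6 ≤ n) {z ε : ℂ} (h0 : z ≠ 0)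
    (h1 : z * beta n ≠ 1) (hε : ε * ε = 1)
    (hw : (z * beta n) ^ n * (z * beta n - 2) = 2 * ε) :
    (markovEnd n).HasEigenvector z
      (fun i : Fin (2 * n + 4) => eigVec n (z * beta n) ε i) := by
  have hb : (beta n : ℂ) ≠ 0 := by exact_mod_cast (beta_pos n).ne'
  refine ⟨?_, ?_⟩
  · rw [Module.End.mem_eigenspace_iff, markov_eigen_iff hn]
    refine (eigVec_isAdjEigen hn (mul_ne_zero h0 hb) hε hw).congr fun j hj => ?_
    rw [extVec, dif_pos hj]
  · intro h
    have := congrFun h ⟨n, by omega⟩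
    simp only [eigVec_n, Pi.zero_apply] at this
    exact h1 (sub_eq_zero.1 this)

/-- If neither characteristic equation held, the even and the odd part of an eigenvector would both
vanish. -/
theorem markov_root_of_hasEigenvalue {n : ℕ} (hn : 6 ≤ n) {z : ℂ}
    (h0 : z ≠ 0) (h1 : z * beta n ≠ 1)
    (hz : (markovEnd n).HasEigenvalue z) :
    ∃ ε : ℂ, (ε = 1 ∨ ε = -1) ∧ (z * beta n) ^ n * (z * beta n - 2) = 2 * ε := by
  have hb : (beta n : ℂ) ≠ 0 := by exact_mod_cast (beta_pos n).ne'
  have hw := mul_ne_zero h0 hb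
  obtain ⟨v, hv, hv0⟩ := hz.exists_hasEigenvector
  rw [Module.End.mem_eigenspace_iff, markov_eigen_iff hn] at hv
  by_contra hcon
  push Not at hcon
  have key : ∀ ε : ℂ, (ε = 1 ∨ ε = -1) →
      ∀ i < 2 * n + 4, extVec v i + ε * extVec v (2 * n + 3 - i) = 0 := by
    intro ε hε
    have hεε : ε * ε = 1 := by rcases hε with rfl | rfl <;> norm_num
    have h2 := hv.add (hv.rev hn) ε
    have h3 : HasParity n ε (fun j => extVec v j + ε * extVec v (2 * n + 3 - j)) := by
      intro i hi
      simp only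
      rw [show 2 * n + 3 - (2 * n + 3 - i) = i by omega]
      linear_combination -extVec v (2 * n + 3 - i) * hεε
    refine h2.eq_zero hn h3 hw h1 ?_
    exact (mul_eq_zero.1 (h2.charpoly hn h3 hw)).resolve_right (sub_ne_zero.2 (hcon ε hε))
  refine hv0 (funext fun i => ?_)
  have e1 := key 1 (Or.inl rfl) i i.2
  have e2 := key (-1) (Or.inr rfl) i i.2
  rw [← extVec_coe v, Pi.zero_apply]
  linear_combination (e1 + e2) / 2

theorem markov_eigenspace_one {n : ℕ} (hn : 6 ≤ n) {v : Fin (2 * n + 4) → ℂ}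
    (hv : markovEnd n v = v) :
    ∃ c : ℂ, v = c • fun i : Fin (2 * n + 4) => eigVec n (beta n) 1 i := by
  have hb2 := two_lt_beta n
  have hb : (beta n : ℂ) ≠ 0 := by exact_mod_cast (beta_pos n).ne'
  have hb1 : (beta n : ℂ) ≠ 1 := by
    have : beta n ≠ 1 := by linarith
    exact_mod_cast this
  have hb1' : (beta n : ℂ) - 1 ≠ 0 := sub_ne_zero.2 hb1
  have hv' : IsAdjEigen n (beta n) (extVec v) := by
    have := (markov_eigen_iff hn v 1).1 (by rw [hv, one_smul])
    rwa [one_mul] at this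
  -- At w = β the odd equation would read 2 = -2, so the odd part vanishes.
  have hodd : ∀ i < 2 * n + 4, extVec v i + -1 * extVec v (2 * n + 3 - i) = 0 := by
    have h2 := hv'.add (hv'.rev hn) (-1)
    have h3 : HasParity n (-1) (fun j => extVec v j + -1 * extVec v (2 * n + 3 - j)) := by
      intro i hi
      simp only
      rw [show 2 * n + 3 - (2 * n + 3 - i) = i by omega]
      ring
    refine h2.eq_zero hn h3 hb hb1 ?_
    refine (mul_eq_zero.1 (h2.charpoly hn h3 hb)).resolve_right ?_
    rw [beta_root]
    norm_num
  have hpar : HasParity n 1 (extVec v) := fun i hi => by linear_combination -hodd i hi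
  -- Chosen so that v - c · `eigVec` vanishes at index n, where `eigVec` equals β - 1.
  set c := extVec v n / (beta n - 1) with hc
  have heig := eigVec_isAdjEigen hn hb (one_mul 1) (beta_root n)
  have h4 := hv'.add heig (-c)
  have h5 : HasParity n 1 (fun j => extVec v j + -c * eigVec n (beta n) 1 j) := by
    intro i hi
    simp only
    rw [hpar i hi, eigVec_parity n _ (one_mul 1) i hi]
    ring
  have h6 := h4.eq_zero hn h5 hb hb1 (by
    rw [eigVec_n, hc]
    field_simp
    ring)
  refine ⟨c, funext fun i => ?_⟩
  have := h6 i i.2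
  rw [extVec_coe] at this
  simp only [Pi.smul_apply, smul_eq_mul]
  linear_combination this

theorem eigVec_beta_pos {n i : ℕ} : ∃ p : ℝ, 0 < p ∧ eigVec n (beta n) 1 i = p := by
  have hb2 := two_lt_beta n
  have hleft : ∀ i, ∃ p : ℝ, 0 < p ∧ eigLeft n (beta n) 1 i = p := by
    intro i
    have hb := beta_pos n
    unfold eigLeft
    split_ifs
    · exact ⟨1 + 2 * 1 / beta n ^ (i + 1), by positivity, by push_cast; ring⟩
    · exact ⟨beta n - 1, by linarith, by push_cast; ring⟩
    · refine ⟨(beta n - 1) * (1 + 2 * 1 / beta n), ?_, by push_cast; ring⟩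
      have : 0 < beta n - 1 := by linarith
      positivity
  unfold eigVec
  split_ifs
  · exact hleft i
  · rw [one_mul]
    exact hleft _

/-! ### Invariance of the integral and simplicity of the eigenvalue 1 -/

/-- The integral of the step function with values `V`. -/
noncomputable def cellIntegral (n : ℕ) (V : ℕ → ℂ) : ℂ :=
  ∑ i ∈ Finset.range (2 * n + 4), ((endpt n (i + 1) - endpt n i : ℝ) : ℂ) * V i

/-- Column j of A_n, weighted by cell lengths, adds up to the length of the image of cell j, which
is β times that of the cell. -/
theorem cellIntegral_adjAction {n : ℕ} (hn : 6 ≤ n) (V : ℕ → ℂ) :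
    cellIntegral n (adjAction n V) = beta n * cellIntegral n V := by
  unfold cellIntegral adjAction
  simp only [Finset.mul_sum]
  rw [Finset.sum_comm]
  refine Finset.sum_congr rfl fun j hj => ?_
  rw [Finset.mem_range] at hj
  have h1 : ∀ i, ((endpt n (i + 1) - endpt n i : ℝ) : ℂ) *
      (if lo n j ≤ i ∧ i < hi n j then V j else 0) =
      if lo n j ≤ i ∧ i < hi n j then ((endpt n (i + 1) - endpt n i : ℝ) : ℂ) * V j else 0 :=
    fun i => by split_ifs <;> simp
  simp only [h1]
  rw [← Finset.sum_filter]
  have h2 : (Finset.range (2 * n + 4)).filter (fun i => lo n j ≤ i ∧ i < hi n j) =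
      Finset.Ico (lo n j) (hi n j) := by
    have := hi_le (j := j) hn
    ext i
    simp only [Finset.mem_filter, Finset.mem_range, Finset.mem_Ico]
    omega
  rw [h2, ← Finset.sum_mul, ← Complex.ofReal_sum, Finset.sum_Ico_eq_sub _ (lo_lt_hi hn hj).le,
    Finset.sum_range_sub, Finset.sum_range_sub, ← mul_assoc, ← Complex.ofReal_mul,
    ← endpt_hi_sub_lo hn hj]
  congr 2
  ring

/-- If L v = v + c v₀ with v₀ the positive fixed vector, integrating both sides gives c ∫ v₀ = 0, so
c = 0. Hence no Jordan chain goes beyond the fixed line. -/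
theorem markov_maxGenEigenspace_one {n : ℕ} (hn : 6 ≤ n) :
    Module.finrank ℂ ((markovEnd n).maxGenEigenspace 1) = 1 := by
  have hb2 := two_lt_beta n
  have hb : (beta n : ℂ) ≠ 0 := by exact_mod_cast (beta_pos n).ne'
  set L := markovEnd n with hL
  set v₀ : Fin (2 * n + 4) → ℂ := fun i => eigVec n (beta n) 1 i with hv₀
  have hb1 : (1 : ℂ) * beta n ≠ 1 := by
    have : beta n ≠ 1 := by linarith
    rw [one_mul]
    exact_mod_cast this
  have heig : L.HasEigenvector 1 v₀ := by
    have := markov_hasEigenvector hn (one_ne_zero) hb1 (one_mul 1)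
      (by rw [one_mul]; exact beta_root n)
    rwa [one_mul] at this
  have hint : cellIntegral n (extVec v₀) ≠ 0 := by
    choose p hp hpe using fun i => eigVec_beta_pos (n := n) (i := i)
    have : cellIntegral n (extVec v₀) =
        ((∑ i ∈ Finset.range (2 * n + 4), (endpt n (i + 1) - endpt n i) * p i : ℝ) : ℂ) := by
      rw [cellIntegral, Complex.ofReal_sum]
      refine Finset.sum_congr rfl fun i hi => ?_
      rw [extVec, dif_pos (Finset.mem_range.1 hi), Complex.ofReal_mul, ← hpe i]
    rw [this, Complex.ofReal_ne_zero]
    refine (Finset.sum_pos (fun i hi => mul_pos ?_ (hp i)) ⟨0, by simp⟩).ne'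
    exact sub_pos.2 (endpt_lt_succ (by omega) (Finset.mem_range.1 hi))
  have hkey : ∀ k : ℕ, ∀ v, ((L - (1 : ℂ) • 1) ^ k) v = 0 → ∃ c : ℂ, v = c • v₀ := by
    intro k
    induction k with
    | zero =>
      intro v hv
      exact ⟨0, by simpa using hv⟩
    | succ k ih =>
      intro v hv
      rw [pow_succ, Module.End.mul_apply] at hv
      obtain ⟨c, hc⟩ := ih _ hv
      have hc' : ∀ i : Fin (2 * n + 4), L v i = v i + c * v₀ i := by
        intro i
        have := congrFun hc i
        simp only [one_smul, LinearMap.sub_apply, Module.End.one_apply, Pi.sub_apply,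
          Pi.smul_apply, smul_eq_mul] at this
        linear_combination this
      have h1 : cellIntegral n (adjAction n (extVec v)) =
          beta n * (cellIntegral n (extVec v) + c * cellIntegral n (extVec v₀)) := by
        unfold cellIntegral
        rw [Finset.mul_sum, ← Finset.sum_add_distrib, Finset.mul_sum]
        refine Finset.sum_congr rfl fun i hi => ?_
        have h2 := hc' ⟨i, Finset.mem_range.1 hi⟩
        rw [hL, markovEnd_apply hn, ← extVec_coe v, ← extVec_coe v₀] at h2
        have h3 : adjAction n (extVec v) i = beta n * (extVec v i + c * extVec v₀ i) := by
          rw [← h2]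
          field_simp
        rw [h3]
        ring
      rw [cellIntegral_adjAction hn] at h1
      have h2 := mul_left_cancel₀ hb h1
      have h3 : c = 0 := by
        have : c * cellIntegral n (extVec v₀) = 0 := by linear_combination -h2
        exact (mul_eq_zero.1 this).resolve_right hint
      refine markov_eigenspace_one hn (funext fun i => ?_)
      rw [← hL, hc' i, h3]
      ring
  have hspan : L.maxGenEigenspace 1 = Submodule.span ℂ {v₀} := by
    ext v
    rw [Module.End.mem_maxGenEigenspace, Submodule.mem_span_singleton]
    constructor
    · rintro ⟨k, hk⟩
      obtain ⟨c, hc⟩ := hkey k v hk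
      exact ⟨c, hc.symm⟩
    · rintro ⟨c, rfl⟩
      refine ⟨1, ?_⟩
      rw [pow_one, map_smul, LinearMap.sub_apply, heig.apply_eq_smul]
      simp
  rw [hspan, finrank_span_singleton heig.2]

/-- The two largest eigenvalues of `M_n` are `1` and `w / β_n`, where `w` is the root of
`w ^ n (2 - w) = 2` in `(3 / 2, 2)`. -/
theorem markov_isTopTwo {n : ℕ} (hn : 6 ≤ n) {w : ℝ} (h1 : 3 / 2 < w) (h2 : w < 2)
    (h3 : w ^ n * (2 - w) = 2) :
    IsTopTwo (markovEnd n) 1 ((w / beta n : ℝ) : ℂ) := by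
  have hb2 := two_lt_beta n
  have hb0 := beta_pos n
  have hb : (beta n : ℂ) ≠ 0 := by exact_mod_cast (beta_pos n).ne'
  have hb1 : (1 : ℂ) * beta n ≠ 1 := by
    have : beta n ≠ 1 := by linarith
    rw [one_mul]
    exact_mod_cast this
  have hμ : ((w / beta n : ℝ) : ℂ) * beta n = w := by
    push_cast
    field_simp
  have hw1 : (w : ℂ) ≠ 1 := by
    have : w ≠ 1 := by linarith
    exact_mod_cast this
  have hwroot : (w : ℂ) ^ n * (w - 2) = 2 * (-1) := by
    have : w ^ n * (w - 2) = 2 * (-1) := by linear_combination -h3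
    exact_mod_cast this
  have hnorm : ‖((w / beta n : ℝ) : ℂ)‖ = w / beta n := by
    rw [Complex.norm_real, Real.norm_of_nonneg (by positivity)]
  refine ⟨?_, markov_maxGenEigenspace_one hn, ?_, ?_, ?_⟩
  · exact Module.End.hasEigenvalue_of_hasEigenvector (markov_hasEigenvector hn (one_ne_zero) hb1
      (one_mul 1) (by rw [one_mul]; exact beta_root n))
  · refine Module.End.hasEigenvalue_of_hasEigenvector (markov_hasEigenvector hn (ε := -1) ?_ ?_
      (by norm_num) (by rw [hμ]; exact hwroot))
    · have : w / beta n ≠ 0 := by positivity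
      exact_mod_cast this
    · rwa [hμ]
  · rw [hnorm, norm_one, div_lt_one hb0]
    linarith
  · intro z hz hz1 hz2
    by_contra hcon
    rw [not_lt, hnorm, div_le_iff₀ hb0] at hcon
    -- A competitor of modulus at least w/β gives a root of modulus at least w > 3/2, where each
    -- characteristic equation has only one root.
    have hzn : 3 / 2 ≤ ‖z * beta n‖ := by
      rw [norm_mul, Complex.norm_real, Real.norm_of_nonneg hb0.le]
      linarith
    rw [← Module.End.hasEigenvalue_iff_mem_spectrum] at hz
    obtain ⟨ε, hε, hroot⟩ := markov_root_of_hasEigenvalue hn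
      (by intro h; rw [h] at hzn; norm_num at hzn) (by intro h; rw [h] at hzn; norm_num at hzn) hz
    rcases hε with rfl | rfl
    · have := root_unique hn norm_one hzn (w' := beta n)
        (by rw [Complex.norm_real, Real.norm_of_nonneg hb0.le]; linarith) hroot (beta_root n)
      exact hz1 (mul_right_cancel₀ hb (by rw [this, one_mul]))
    · have := root_unique hn (by simp) hzn (w' := w)
        (by rw [Complex.norm_real, Real.norm_of_nonneg (by linarith)]; linarith) hroot hwroot
      exact hz2 (mul_right_cancel₀ hb (by rw [this, hμ]))

/-! ### Variation of sums, and functions of bounded variation as elements of `BV` -/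

theorem eVariationOn_add_le (f g : ℝ → ℂ) (s : Set ℝ) :
    eVariationOn (fun x => f x + g x) s ≤ eVariationOn f s + eVariationOn g s := by
  refine iSup_le fun p => ?_
  calc ∑ i ∈ Finset.range p.1, edist (f (p.2.1 (i + 1)) + g (p.2.1 (i + 1)))
        (f (p.2.1 i) + g (p.2.1 i))
      ≤ ∑ i ∈ Finset.range p.1, (edist (f (p.2.1 (i + 1))) (f (p.2.1 i))
          + edist (g (p.2.1 (i + 1))) (g (p.2.1 i))) :=
        Finset.sum_le_sum fun i _ => edist_add_add_le _ _ _ _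
    _ ≤ _ := by
        rw [Finset.sum_add_distrib]
        exact add_le_add (eVariationOn.sum_le p.2.2.1 p.2.2.2)
          (eVariationOn.sum_le p.2.2.1 p.2.2.2)

theorem eVariationOn_const (c : ℂ) (s : Set ℝ) : eVariationOn (fun _ : ℝ => c) s = 0 :=
  eVariationOn.constant_on fun _ ⟨_, _, hx⟩ _ ⟨_, _, hy⟩ => hx.symm.trans hy

theorem eVariationOn_sum_le {ι : Type*} (t : Finset ι) (F : ι → ℝ → ℂ) (s : Set ℝ) :
    eVariationOn (fun x => ∑ i ∈ t, F i x) s ≤ ∑ i ∈ t, eVariationOn (F i) s := by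
  classical
  induction t using Finset.induction_on with
  | empty => simp [eVariationOn_const]
  | insert a t ha ih =>
    simp only [Finset.sum_insert ha]
    exact (eVariationOn_add_le _ _ _).trans (add_le_add le_rfl ih)

theorem eVariationOn_const_mul_le (c : ℂ) (f : ℝ → ℂ) (s : Set ℝ) :
    eVariationOn (fun x => c * f x) s ≤ ‖c‖ₑ * eVariationOn f s := by
  refine iSup_le fun p => ?_
  calc ∑ i ∈ Finset.range p.1, edist (c * f (p.2.1 (i + 1))) (c * f (p.2.1 i))
      = ‖c‖ₑ * ∑ i ∈ Finset.range p.1, edist (f (p.2.1 (i + 1))) (f (p.2.1 i)) := by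
        rw [Finset.mul_sum]
        exact Finset.sum_congr rfl fun i _ => edist_smul₀ c _ _
    _ ≤ _ := by
        gcongr
        exact eVariationOn.sum_le p.2.2.1 p.2.2.2

theorem eVariationOn_add_const_le (f : ℝ → ℂ) (c : ℂ) (s : Set ℝ) :
    eVariationOn (fun x => f x + c) s ≤ eVariationOn f s := by
  refine (eVariationOn_add_le f (fun _ => c) s).trans ?_
  rw [eVariationOn_const, add_zero]

theorem bv_indicator_Ico {g : ℝ → ℂ} {a b : ℝ} (hab : a ≤ b)
    (hg : BoundedVariationOn g (Icc a b)) : BoundedVariationOn ((Ico a b).indicator g) univ := by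
  have hcl : BoundedVariationOn (fun x => g (max a (min b x))) univ := by
    refine ne_top_of_le_ne_top hg (eVariationOn.comp_le_of_monotoneOn g _ ?_ ?_)
    · intro x _ y _ hxy
      exact max_le_max le_rfl (min_le_min le_rfl hxy)
    · intro x _
      exact ⟨le_max_left _ _, max_le hab (min_le_left _ _)⟩
  -- The indicator times g is a difference of two steps times g composed with the projection to [a,
  -- b].
  have h := bv_mul (bv_add (bv_step a) (bv_smul (-1) (bv_step b))) hcl
  convert h using 1
  ext x
  simp only [Pi.mul_apply, Pi.add_apply, Pi.smul_apply, smul_eq_mul]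
  by_cases hx : x ∈ Ico a b
  · rw [indicator_of_mem hx, if_pos hx.1, if_neg (not_le.2 hx.2), min_eq_right hx.2.le,
      max_eq_right hx.1]
    simp
  · rw [indicator_of_notMem hx]
    rw [mem_Ico, not_and_or, not_le, not_lt] at hx
    rcases hx with hx | hx
    · rw [if_neg (not_le.2 hx), if_neg (not_le.2 (by linarith))]
      simp
    · rw [if_pos (by linarith), if_pos hx]
      simp

theorem measurable_of_boundedVariationOn_real {f : ℝ → ℝ} (hf : BoundedVariationOn f univ) :
    Measurable f := by
  obtain ⟨p, q, hp, hq, rfl⟩ := hf.locallyBoundedVariationOn.exists_monotoneOn_sub_monotoneOn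
  exact (monotoneOn_univ.1 hp).measurable.sub (monotoneOn_univ.1 hq).measurable

theorem measurable_of_boundedVariationOn {f : ℝ → ℂ} (hf : BoundedVariationOn f univ) :
    Measurable f := by
  have hre : Measurable fun x => (f x).re := measurable_of_boundedVariationOn_real
    (Complex.reCLM.lipschitz.comp_boundedVariationOn hf)
  have him : Measurable fun x => (f x).im := measurable_of_boundedVariationOn_real
    (Complex.imCLM.lipschitz.comp_boundedVariationOn hf)
  exact measurable_of_re_im hre him

theorem integrable_of_boundedVariationOn {f : ℝ → ℂ} (hf : BoundedVariationOn f univ) :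
    Integrable f leb := by
  obtain ⟨C, hC⟩ := bv_bound hf
  exact Integrable.of_bound (measurable_of_boundedVariationOn hf).aestronglyMeasurable C
    (Eventually.of_forall fun x => by exact_mod_cast hC x (mem_univ x))

/-- The class in `BV` of a function of bounded variation. -/
noncomputable def bvMk (f : ℝ → ℂ) (hf : BoundedVariationOn f univ) : BV :=
  ⟨(integrable_of_boundedVariationOn hf).toL1 f, f, hf.mono (subset_univ _),
    (integrable_of_boundedVariationOn hf).coeFn_toL1⟩

theorem coeFn_bvMk (f : ℝ → ℂ) (hf : BoundedVariationOn f univ) :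
    ((bvMk f hf : BV) : Lp ℂ 1 leb) =ᵐ[leb] f :=
  (integrable_of_boundedVariationOn hf).coeFn_toL1

theorem BV_ext {f g : BV} (h : (f : Lp ℂ 1 leb) =ᵐ[leb] (g : Lp ℂ 1 leb)) : f = g :=
  Subtype.ext (Lp.ext h)

theorem coeFn_BV_add (f g : BV) :
    ((f + g : BV) : Lp ℂ 1 leb) =ᵐ[leb] fun x => (f : Lp ℂ 1 leb) x + (g : Lp ℂ 1 leb) x :=
  Lp.coeFn_add _ _

theorem coeFn_BV_smul (c : ℂ) (f : BV) :
    ((c • f : BV) : Lp ℂ 1 leb) =ᵐ[leb] fun x => c * (f : Lp ℂ 1 leb) x :=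
  Lp.coeFn_smul _ _

/-! ### Families of functions on the closed cells -/

/-- The function equal to `F j` on the `j`-th cell. -/
noncomputable def glue (n : ℕ) (F : ℕ → ℝ → ℂ) (x : ℝ) : ℂ :=
  ∑ j ∈ Finset.range (2 * n + 4), (Ico (endpt n j) (endpt n (j + 1))).indicator (F j) x

/-- The inverse branch on the `j`-th cell, composed with the projection to that cell. -/
noncomputable def clampBwd (n j : ℕ) (x : ℝ) : ℝ :=
  max (endpt n j) (min (endpt n (j + 1)) (bwd n j x))

/-- The transfer operator of `T_{κ_n}` on families of functions on the closed cells. -/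
noncomputable def transfer (n : ℕ) (F : ℕ → ℝ → ℂ) (i : ℕ) (x : ℝ) : ℂ :=
  (beta n : ℂ)⁻¹ * adjAction n (fun j => F j (clampBwd n j x)) i

/-- The sum of the variations of a family over the closed cells. -/
noncomputable def totalVar (n : ℕ) (F : ℕ → ℝ → ℂ) : ℝ≥0∞ :=
  ∑ j ∈ Finset.range (2 * n + 4), eVariationOn (F j) (Icc (endpt n j) (endpt n (j + 1)))

theorem clampBwd_mem {n : ℕ} (hn : 1 ≤ n) (j : ℕ) (x : ℝ) :
    clampBwd n j x ∈ Icc (endpt n j) (endpt n (j + 1)) :=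
  ⟨le_max_left _ _, max_le (endpt_mono hn (Nat.le_succ j)) (min_le_left _ _)⟩

theorem clampBwd_eq {n j : ℕ} {x : ℝ} (h : bwd n j x ∈ Icc (endpt n j) (endpt n (j + 1))) :
    clampBwd n j x = bwd n j x := by
  rw [clampBwd, min_eq_right h.2, max_eq_right h.1]

theorem eVariationOn_comp_clampBwd_le {n : ℕ} (hn : 1 ≤ n) (f : ℝ → ℂ) (j : ℕ) (s : Set ℝ) :
    eVariationOn (fun x => f (clampBwd n j x)) s ≤
      eVariationOn f (Icc (endpt n j) (endpt n (j + 1))) := by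
  rcases le_total 0 (brSlope (kappa n) (br n j)) with h | h
  · refine eVariationOn.comp_le_of_monotoneOn f (clampBwd n j) ?_ fun x _ => clampBwd_mem hn j x
    intro x _ y _ hxy
    exact max_le_max le_rfl (min_le_min le_rfl (div_le_div_of_nonneg_right (by linarith) h))
  · refine eVariationOn.comp_le_of_antitoneOn f (clampBwd n j) ?_ fun x _ => clampBwd_mem hn j x
    intro x _ y _ hxy
    exact max_le_max le_rfl (min_le_min le_rfl (div_le_div_of_nonpos_of_le h (by linarith)))

theorem enorm_beta_inv (n : ℕ) : ‖(beta n : ℂ)⁻¹‖ₑ = ENNReal.ofReal (beta n)⁻¹ := by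
  rw [← ofReal_norm, norm_inv, Complex.norm_real, Real.norm_of_nonneg (beta_pos n).le]

/-- Each F_j, composed with the clamped inverse branch, has total variation over all cells at most
that of F_j on cell j, since clamped inverse branches are monotone or antitone. The only surviving
factor is 1/β: no boundary terms occur, because jumps between cells are not counted. -/
theorem totalVar_transfer_le {n : ℕ} (hn : 1 ≤ n) (F : ℕ → ℝ → ℂ) :
    totalVar n (transfer n F) ≤ ENNReal.ofReal (beta n)⁻¹ * totalVar n F := by
  unfold totalVar
  calc ∑ i ∈ Finset.range (2 * n + 4),
        eVariationOn (transfer n F i) (Icc (endpt n i) (endpt n (i + 1)))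
      ≤ ∑ i ∈ Finset.range (2 * n + 4), ENNReal.ofReal (beta n)⁻¹ *
          ∑ j ∈ Finset.range (2 * n + 4),
            eVariationOn (fun x => F j (clampBwd n j x)) (Icc (endpt n i) (endpt n (i + 1))) := by
        refine Finset.sum_le_sum fun i _ => ?_
        rw [← enorm_beta_inv]
        refine (eVariationOn_const_mul_le _ _ _).trans ?_
        gcongr
        refine (eVariationOn_sum_le _ _ _).trans (Finset.sum_le_sum fun j _ => ?_)
        split_ifs
        · exact le_rfl
        · rw [eVariationOn_const]
          exact zero_le
    _ = ENNReal.ofReal (beta n)⁻¹ * ∑ j ∈ Finset.range (2 * n + 4),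
          eVariationOn (fun x => F j (clampBwd n j x)) (Icc (endpt n 0) (endpt n (2 * n + 4))) := by
        rw [← Finset.mul_sum, Finset.sum_comm]
        congr 1
        -- The variations over consecutive cells add up to the variation over [-1, 1].
        exact Finset.sum_congr rfl fun j _ => eVariationOn.sum' _ (endpt_mono hn)
    _ ≤ _ := by
        gcongr with j _
        exact eVariationOn_comp_clampBwd_le hn (F j) j _

theorem glue_apply {n i : ℕ} (hn : 1 ≤ n) (hi : i < 2 * n + 4) (F : ℕ → ℝ → ℂ) {x : ℝ}
    (hx : x ∈ Ico (endpt n i) (endpt n (i + 1))) : glue n F x = F i x := by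
  rw [glue, Finset.sum_eq_single_of_mem i (Finset.mem_range.2 hi), indicator_of_mem hx]
  intro j _ hj
  refine indicator_of_notMem (fun h => ?_) _
  rcases lt_or_gt_of_ne hj with h1 | h1
  · exact absurd (h.2.trans_le (endpt_mono hn (show j + 1 ≤ i from h1))) (not_lt.2 hx.1)
  · exact absurd (hx.2.trans_le (endpt_mono hn (show i + 1 ≤ j from h1))) (not_lt.2 h.1)

theorem bv_glue {n : ℕ} (hn : 1 ≤ n) {F : ℕ → ℝ → ℂ} (hF : totalVar n F ≠ ∞) :
    BoundedVariationOn (glue n F) univ := by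
  refine ne_top_of_le_ne_top ?_ (eVariationOn_sum_le _ _ _)
  refine (ENNReal.sum_lt_top.2 fun j hj => ?_).ne
  exact (bv_indicator_Ico (endpt_mono hn (Nat.le_succ j))
    ((ENNReal.sum_lt_top.1 (lt_top_iff_ne_top.2 hF)) j hj).ne).lt_top

theorem disjoint_brSet {b b' : Fin 4} {y : ℝ} (h : y ∈ brSet b) (h' : y ∈ brSet b') : b = b' := by
  rw [mem_brSet_iff] at h h'
  fin_cases b <;> fin_cases b' <;> first
    | rfl
    | (exfalso
       simp [brLeft] at h h'
       linarith [h.1, h.2, h'.1, h'.2])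

/-- Every cell lies in one of the four branches, so the sum over branches can be regrouped as a sum
over cells; the cells that contribute at x are those whose image contains the cell of x. -/
theorem pfFormula_glue {n i : ℕ} (hn : 6 ≤ n) (F : ℕ → ℝ → ℂ) {x : ℝ}
    (hx : x ∈ Ioo (endpt n i) (endpt n (i + 1))) :
    pfFormula (kappa n) (glue n F) x = transfer n F i x := by
  classical
  have hn1 : 1 ≤ n := by omega
  have h1 : ∀ b : Fin 4, (brSet b).indicator (glue n F)
      ((x - brConst (kappa n) b) / brSlope (kappa n) b) =
      ∑ j ∈ Finset.range (2 * n + 4), if b = br n j then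
        (Ico (endpt n j) (endpt n (j + 1))).indicator (F j) (bwd n j x) else 0 := by
    intro b
    set y := (x - brConst (kappa n) b) / brSlope (kappa n) b with hy
    have h2 : ∀ j ∈ Finset.range (2 * n + 4), (if b = br n j then
        (Ico (endpt n j) (endpt n (j + 1))).indicator (F j) (bwd n j x) else 0) =
        if y ∈ brSet b then (Ico (endpt n j) (endpt n (j + 1))).indicator (F j) y else 0 := by
      intro j hj
      rw [Finset.mem_range] at hj
      by_cases hb : b = br n j
      · have : bwd n j x = y := by rw [hy, hb]; rfl
        rw [if_pos hb, this]
        split_ifs with hyb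
        · rfl
        · exact indicator_of_notMem (fun h => hyb (hb ▸ mem_brSet_of_mem_cell hn hj h)) _
      · rw [if_neg hb]
        split_ifs with hyb
        · refine (indicator_of_notMem (fun h => hb ?_) _).symm
          exact disjoint_brSet hyb (mem_brSet_of_mem_cell hn hj h)
        · rfl
    rw [Finset.sum_congr rfl h2]
    by_cases hyb : y ∈ brSet b
    · simp only [if_pos hyb, indicator_of_mem hyb]
      rfl
    · simp only [if_neg hyb, indicator_of_notMem hyb, Finset.sum_const_zero]
  unfold pfFormula
  simp only [h1, abs_brSlope]
  rw [← Finset.mul_sum, Finset.sum_comm, transfer, adjAction, Complex.ofReal_inv]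
  congr 1
  refine Finset.sum_congr rfl fun j hj => ?_
  rw [Finset.mem_range] at hj
  rw [Finset.sum_ite_eq' Finset.univ (br n j), if_pos (Finset.mem_univ _)]
  split_ifs with h
  · have hmem := (bwd_mem_Ioo hn hj).2
      (Ioo_subset_Ioo (endpt_mono hn1 h.1) (endpt_mono hn1 h.2) hx)
    rw [indicator_of_mem (Ioo_subset_Ico_self hmem), clampBwd_eq (Ioo_subset_Icc_self hmem)]
  · refine indicator_of_notMem (fun hc => h ?_) _
    have hmem := (bwd_mem_Icc hn hj).1 ⟨hc.1, hc.2.le⟩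
    constructor
    · by_contra hlt
      exact absurd (hmem.1.trans_lt hx.2) (not_lt.2 (endpt_mono hn1 (by omega)))
    · by_contra hlt
      exact absurd (hx.1.trans_le hmem.2) (not_lt.2 (endpt_mono hn1 (by omega)))

/-! ### Null sets and cells -/

theorem exists_cell {n : ℕ} (hn : 1 ≤ n) {x : ℝ} (hx : x ∈ Icc (-1 : ℝ) 1)
    (hr : x ∉ range (endpt n)) : ∃ i < 2 * n + 4, x ∈ Ioo (endpt n i) (endpt n (i + 1)) := by
  have h1 : x < endpt n (2 * n + 4) := by
    refine lt_of_le_of_ne ?_ fun h => hr ⟨_, h.symm⟩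
    rw [endpt_of_le hn le_rfl]
    exact hx.2
  have hex : ∃ i, x < endpt n i := ⟨_, h1⟩
  classical
  have h2 := Nat.find_spec hex
  have h3 : Nat.find hex ≠ 0 := by
    intro h
    rw [h, endpt_zero] at h2
    linarith [hx.1]
  have h4 := Nat.find_min' hex h1
  have h5 := Nat.find_min hex (show Nat.find hex - 1 < Nat.find hex by omega)
  refine ⟨Nat.find hex - 1, by omega, lt_of_le_of_ne (not_lt.1 h5) fun h => hr ⟨_, h⟩, ?_⟩
  rwa [Nat.sub_add_cancel (by omega)]

theorem ae_mem_cell {n : ℕ} (hn : 1 ≤ n) :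
    ∀ᵐ x ∂leb, ∃ i < 2 * n + 4, x ∈ Ioo (endpt n i) (endpt n (i + 1)) := by
  refine Measure.ae_smul_measure ?_ _
  filter_upwards [ae_restrict_mem measurableSet_Icc,
    ae_restrict_of_ae ((countable_range (endpt n)).ae_notMem volume)] with x h1 h2
  exact exists_cell hn h1 h2

/-- Each cell has positive measure. -/
theorem exists_mem_cell_of_ae {n i : ℕ} (hn : 1 ≤ n) (hi : i < 2 * n + 4) {p : ℝ → Prop}
    (hp : ∀ᵐ x ∂leb, p x) : ∃ x ∈ Ioo (endpt n i) (endpt n (i + 1)), p x := by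
  by_contra hcon
  push Not at hcon
  have h1 : leb (Ioo (endpt n i) (endpt n (i + 1))) = 0 :=
    measure_mono_null (fun x hx => hcon x hx) (ae_iff.1 hp)
  have h2 : Ioo (endpt n i) (endpt n (i + 1)) ⊆ Icc (-1) 1 := fun x hx =>
    ⟨(endpt_mem_Icc hn i).1.trans hx.1.le, hx.2.le.trans (endpt_mem_Icc hn (i + 1)).2⟩
  rw [leb, Measure.smul_apply, Measure.restrict_eq_self _ h2, Real.volume_Ioo, smul_eq_mul,
    mul_eq_zero] at h1
  rcases h1 with h1 | h1
  · simp at h1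
  · rw [ENNReal.ofReal_eq_zero] at h1
    linarith [endpt_lt_succ hn hi]

/-! ### Step functions -/

theorem bv_glue_const (n : ℕ) (V : ℕ → ℂ) : BoundedVariationOn (glue n fun j _ => V j) univ := by
  refine ne_top_of_le_ne_top ?_ (eVariationOn_sum_le _ _ _)
  refine (ENNReal.sum_lt_top.2 fun j _ => ?_).ne
  -- Without n ≥ 1 the endpoints need not be ordered; a reversed pair gives an empty piece.
  rcases le_total (endpt n j) (endpt n (j + 1)) with h | h
  · exact (bv_indicator_Ico h (by rw [BoundedVariationOn, eVariationOn_const]; simp)).lt_top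
  · rw [Ico_eq_empty (not_lt.2 h), indicator_empty, eVariationOn_const]
    simp

theorem glue_const_add {n : ℕ} (u v : Fin (2 * n + 4) → ℂ) (x : ℝ) :
    glue n (fun j _ => extVec (u + v) j) x =
      glue n (fun j _ => extVec u j) x + glue n (fun j _ => extVec v j) x := by
  unfold glue
  rw [← Finset.sum_add_distrib]
  refine Finset.sum_congr rfl fun j _ => ?_
  simp only [indicator, extVec]
  split_ifs <;> simp

theorem glue_const_smul {n : ℕ} (c : ℂ) (v : Fin (2 * n + 4) → ℂ) (x : ℝ) :
    glue n (fun j _ => extVec (c • v) j) x = c * glue n (fun j _ => extVec v j) x := by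
  unfold glue
  rw [Finset.mul_sum]
  refine Finset.sum_congr rfl fun j _ => ?_
  simp only [indicator, extVec]
  split_ifs <;> simp

/-- The step function with given values on the cells. -/
noncomputable def stepBV (n : ℕ) : (Fin (2 * n + 4) → ℂ) →ₗ[ℂ] BV where
  toFun v := bvMk (glue n fun j _ => extVec v j) (bv_glue_const n _)
  map_add' u v := by
    refine BV_ext ?_
    filter_upwards [coeFn_bvMk _ (bv_glue_const n (extVec (u + v))),
      coeFn_bvMk _ (bv_glue_const n (extVec u)), coeFn_bvMk _ (bv_glue_const n (extVec v)),
      coeFn_BV_add (bvMk _ (bv_glue_const n (extVec u))) (bvMk _ (bv_glue_const n (extVec v)))]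
      with x h1 h2 h3 h4
    rw [h1, h4, h2, h3, glue_const_add]
  map_smul' c v := by
    refine BV_ext ?_
    filter_upwards [coeFn_bvMk _ (bv_glue_const n (extVec (c • v))),
      coeFn_bvMk _ (bv_glue_const n (extVec v)),
      coeFn_BV_smul c (bvMk _ (bv_glue_const n (extVec v)))] with x h1 h2 h3
    rw [h1, RingHom.id_apply, h3, h2, glue_const_smul]

theorem coeFn_stepBV {n : ℕ} (hn : 1 ≤ n) (v : Fin (2 * n + 4) → ℂ) :
    ∀ᵐ x ∂leb, ∀ i < 2 * n + 4, x ∈ Ioo (endpt n i) (endpt n (i + 1)) →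
      (stepBV n v : Lp ℂ 1 leb) x = extVec v i := by
  filter_upwards [coeFn_bvMk _ (bv_glue_const n (extVec v))] with x h i hi hx
  exact h.trans (glue_apply hn hi _ ⟨hx.1.le, hx.2⟩)

theorem stepBV_injective {n : ℕ} (hn : 1 ≤ n) : Function.Injective (stepBV n) := by
  refine (injective_iff_map_eq_zero _).2 fun v hv => funext fun i => ?_
  have h0 : ∀ᵐ x ∂leb, (stepBV n v : Lp ℂ 1 leb) x = 0 := by
    rw [hv]
    exact Lp.coeFn_zero _ _ _
  obtain ⟨x, hx, h1, h2⟩ := exists_mem_cell_of_ae hn i.2 ((coeFn_stepBV hn v).and h0)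
  rw [← extVec_coe v, ← h1 i i.2 hx, h2, Pi.zero_apply]

/-! ### The Perron–Frobenius operator on glued families -/

theorem pf_ae_eq (n : ℕ) (f : BV) {g : ℝ → ℂ} (h : (f : Lp ℂ 1 leb) =ᵐ[leb] g) :
    (pf n f : Lp ℂ 1 leb) =ᵐ[leb] pfFormula (kappa n) g :=
  pfL1_ae_eq (kappa_pos n).le (kappa_le_one n) f h

theorem pf_of_glue {n : ℕ} (hn : 6 ≤ n) (f : BV) {F : ℕ → ℝ → ℂ}
    (h : (f : Lp ℂ 1 leb) =ᵐ[leb] glue n F) :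
    ∀ᵐ x ∂leb, ∀ i < 2 * n + 4, x ∈ Ioo (endpt n i) (endpt n (i + 1)) →
      (pf n f : Lp ℂ 1 leb) x = transfer n F i x := by
  filter_upwards [pf_ae_eq n f h] with x hx i hi hxi
  rw [hx, pfFormula_glue hn F hxi]

theorem ae_eq_glue {n : ℕ} (hn : 1 ≤ n) {f : BV} {F : ℕ → ℝ → ℂ}
    (h : ∀ᵐ x ∂leb, ∀ i < 2 * n + 4, x ∈ Ioo (endpt n i) (endpt n (i + 1)) →
      (f : Lp ℂ 1 leb) x = F i x) : (f : Lp ℂ 1 leb) =ᵐ[leb] glue n F := by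
  filter_upwards [h, ae_mem_cell hn] with x h1 h2
  obtain ⟨i, hi, hx⟩ := h2
  rw [h1 i hi hx, glue_apply hn hi F ⟨hx.1.le, hx.2⟩]

theorem pf_stepBV {n : ℕ} (hn : 6 ≤ n) (v : Fin (2 * n + 4) → ℂ) :
    pf n (stepBV n v) = stepBV n (markovEnd n v) := by
  have hn1 : 1 ≤ n := by omega
  refine BV_ext ?_
  filter_upwards [pf_of_glue hn (stepBV n v) (coeFn_bvMk _ (bv_glue_const n (extVec v))),
    coeFn_stepBV hn1 (markovEnd n v), ae_mem_cell hn1] with x h1 h2 h3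
  obtain ⟨i, hi, hx⟩ := h3
  rw [h1 i hi hx, h2 i hi hx, extVec, dif_pos hi, markovEnd_apply hn]
  -- For constant pieces the clamped inverse branches play no role, and the transfer operator is
  -- literally β⁻¹ A_n.
  rfl

/-! ### Modulo step functions, `P_n` contracts by `1 / β_n` -/

theorem totalVar_iterate_transfer_le {n : ℕ} (hn : 1 ≤ n) (F : ℕ → ℝ → ℂ) (m : ℕ) :
    totalVar n ((transfer n)^[m] F) ≤ ENNReal.ofReal (beta n)⁻¹ ^ m * totalVar n F := by
  induction m with
  | zero => simp
  | succ m ih =>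
    rw [Function.iterate_succ_apply', pow_succ', mul_assoc]
    exact (totalVar_transfer_le hn _).trans (by gcongr)

theorem norm_sub_le_totalVar {n i : ℕ} (hi : i < 2 * n + 4) {F : ℕ → ℝ → ℂ} {r C : ℝ}
    (hr : 0 ≤ r) (hC : 0 ≤ C) {m : ℕ}
    (h : totalVar n F ≤ ENNReal.ofReal r ^ m * ENNReal.ofReal C) {x y : ℝ}
    (hx : x ∈ Icc (endpt n i) (endpt n (i + 1))) (hy : y ∈ Icc (endpt n i) (endpt n (i + 1))) :
    ‖F i x - F i y‖ ≤ r ^ m * C := by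
  have h1 : edist (F i x) (F i y) ≤ ENNReal.ofReal (r ^ m * C) := by
    rw [ENNReal.ofReal_mul (by positivity), ENNReal.ofReal_pow hr]
    refine ((eVariationOn.edist_le _ hx hy).trans ?_).trans h
    exact Finset.single_le_sum
      (f := fun j => eVariationOn (F j) (Icc (endpt n j) (endpt n (j + 1))))
      (fun _ _ => zero_le) (Finset.mem_range.2 hi)
  rwa [edist_dist, ENNReal.ofReal_le_ofReal_iff (by positivity), dist_eq_norm] at h1

theorem totalVar_ne_top {n : ℕ} (hn : 1 ≤ n) {g : ℝ → ℂ}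
    (hg : BoundedVariationOn g (Icc (-1) 1)) : totalVar n (fun _ => g) ≠ ∞ := by
  refine (ENNReal.sum_lt_top.2 fun j _ => ?_).ne
  refine (lt_of_le_of_lt (eVariationOn.mono g ?_) hg.lt_top)
  exact Icc_subset_Icc (endpt_mem_Icc hn j).1 (endpt_mem_Icc hn (j + 1)).2

/-- If `|z| > 1 / β_n` and `(P_n - z) f` is a step function, then so is `f`. -/
theorem mem_range_stepBV {n : ℕ} (hn : 6 ≤ n) {z : ℂ} (hz : 1 < ‖z‖ * beta n) {f : BV}
    {v : Fin (2 * n + 4) → ℂ} (h : pf n f = z • f + stepBV n v) : ∃ u, f = stepBV n u := by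
  have hn1 : 1 ≤ n := by omega
  have hb := beta_pos n
  have hz0 : 0 < ‖z‖ := by
    by_contra hc
    nlinarith [norm_nonneg z]
  obtain ⟨g, hg, hfg⟩ := f.2
  set G : ℕ → ℝ → ℂ := fun _ => g
  -- Modulo step functions f is an eigenvector for z, and P_n preserves step functions.
  have hstep : ∀ m : ℕ, ∃ u, (pf n ^ m) f = z ^ m • f + stepBV n u := by
    intro m
    induction m with
    | zero => exact ⟨0, by simp⟩
    | succ m ih =>
      obtain ⟨u, hu⟩ := ih
      refine ⟨z ^ m • v + markovEnd n u, ?_⟩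
      rw [pow_succ', Module.End.mul_apply, hu, map_add, map_smul, h, pf_stepBV hn, map_add,
        map_smul, smul_add, smul_smul, ← pow_succ, add_assoc]
  choose u hu using hstep
  have hiter : ∀ m : ℕ, ∀ᵐ x ∂leb, ∀ i < 2 * n + 4, x ∈ Ioo (endpt n i) (endpt n (i + 1)) →
      (((pf n ^ m) f : BV) : Lp ℂ 1 leb) x = ((transfer n)^[m] G) i x := by
    intro m
    induction m with
    | zero =>
      filter_upwards [hfg] with x hx i _ _
      simpa using hx
    | succ m ih =>
      rw [pow_succ', Module.End.mul_apply, Function.iterate_succ']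
      exact pf_of_glue hn _ (ae_eq_glue hn1 ih)
  have hae : ∀ᵐ x ∂leb, ∀ m : ℕ, ∀ i < 2 * n + 4, x ∈ Ioo (endpt n i) (endpt n (i + 1)) →
      ((transfer n)^[m] G) i x = z ^ m * (f : Lp ℂ 1 leb) x + extVec (u m) i := by
    refine ae_all_iff.2 fun m => ?_
    have h2 := coeFn_BV_add (z ^ m • f) (stepBV n (u m))
    rw [← hu m] at h2
    filter_upwards [hiter m, h2, coeFn_BV_smul (z ^ m) f, coeFn_stepBV hn1 (u m)]
      with x e1 e2 e3 e4 i hi hx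
    rw [← e1 i hi hx, e2, e3, e4 i hi hx]
  have hC := totalVar_ne_top hn1 hg
  set C := (totalVar n G).toReal
  have hconst : ∀ x y i, i < 2 * n + 4 → x ∈ Ioo (endpt n i) (endpt n (i + 1)) →
      y ∈ Ioo (endpt n i) (endpt n (i + 1)) →
      (∀ m : ℕ, ∀ i < 2 * n + 4, x ∈ Ioo (endpt n i) (endpt n (i + 1)) →
        ((transfer n)^[m] G) i x = z ^ m * (f : Lp ℂ 1 leb) x + extVec (u m) i) →
      (∀ m : ℕ, ∀ i < 2 * n + 4, y ∈ Ioo (endpt n i) (endpt n (i + 1)) →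
        ((transfer n)^[m] G) i y = z ^ m * (f : Lp ℂ 1 leb) y + extVec (u m) i) →
      (f : Lp ℂ 1 leb) x = (f : Lp ℂ 1 leb) y := by
    intro x y i hi hx hy ex ey
    -- On one cell the step part cancels: z^m (f x - f y) is a difference of values of the m-th
    -- transfer iterate, bounded by β^(-m) C. Letting m → ∞ makes f constant on the cell.
    have hle : ∀ m : ℕ, ‖(f : Lp ℂ 1 leb) x - (f : Lp ℂ 1 leb) y‖ ≤
        ((‖z‖ * beta n)⁻¹) ^ m * C := by
      intro m
      have h3 := norm_sub_le_totalVar hi (inv_nonneg.2 hb.le) ENNReal.toReal_nonneg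
        ((totalVar_iterate_transfer_le hn1 G m).trans_eq (by rw [ENNReal.ofReal_toReal hC]))
        (Ioo_subset_Icc_self hx) (Ioo_subset_Icc_self hy)
      rw [ex m i hi hx, ey m i hi hy, add_sub_add_right_eq_sub, ← mul_sub, norm_mul, norm_pow] at h3
      rw [mul_inv, mul_pow, mul_assoc, inv_pow ‖z‖, ← div_eq_inv_mul, le_div_iff₀ (by positivity)]
      linarith
    have hlim : Tendsto (fun m : ℕ => ((‖z‖ * beta n)⁻¹) ^ m * C) atTop (nhds (0 * C)) :=
      (tendsto_pow_atTop_nhds_zero_of_lt_one (by positivity) (inv_lt_one_of_one_lt₀ hz)).mul_const C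
    have h4 := ge_of_tendsto' hlim hle
    rw [zero_mul] at h4
    exact sub_eq_zero.1 (norm_le_zero_iff.1 h4)
  -- One sample point in each cell at which the almost everywhere identities hold; it supplies the
  -- constant value.
  choose! p hp1 hp2 using fun i (hi : i < 2 * n + 4) => exists_mem_cell_of_ae hn1 hi hae
  refine ⟨fun i => (f : Lp ℂ 1 leb) (p i), BV_ext ?_⟩
  filter_upwards [hae, ae_mem_cell hn1,
    coeFn_stepBV hn1 (fun i : Fin (2 * n + 4) => (f : Lp ℂ 1 leb) (p i))] with x h1 h2 h3
  obtain ⟨i, hi, hx⟩ := h2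
  rw [h3 i hi hx, extVec, dif_pos hi]
  exact hconst x (p i) i hi hx (hp1 i hi) h1 (hp2 i hi)

/-! ### Surjectivity modulo step functions by a recentred Neumann series -/

/-- Subtraction of the value at the left end of each cell. -/
noncomputable def recentre (n : ℕ) (F : ℕ → ℝ → ℂ) (i : ℕ) (x : ℝ) : ℂ :=
  F i x - F i (endpt n i)

theorem totalVar_recentre_le (n : ℕ) (F : ℕ → ℝ → ℂ) :
    totalVar n (recentre n F) ≤ totalVar n F := by
  refine Finset.sum_le_sum fun j _ => ?_
  have := eVariationOn_add_const_le (F j) (-F j (endpt n j)) (Icc (endpt n j) (endpt n (j + 1)))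
  simp only [← sub_eq_add_neg] at this
  exact this

/-- The iterates of the recentred transfer operator. -/
noncomputable def recentredIter (n : ℕ) (F : ℕ → ℝ → ℂ) (m : ℕ) : ℕ → ℝ → ℂ :=
  (fun H => recentre n (transfer n H))^[m] (recentre n F)

theorem recentredIter_succ (n : ℕ) (F : ℕ → ℝ → ℂ) (m i : ℕ) (x : ℝ) :
    recentredIter n F (m + 1) i x =
      transfer n (recentredIter n F m) i x - transfer n (recentredIter n F m) i (endpt n i) := by
  rw [recentredIter, Function.iterate_succ_apply']
  rfl

theorem recentredIter_endpt (n : ℕ) (F : ℕ → ℝ → ℂ) (m i : ℕ) :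
    recentredIter n F m i (endpt n i) = 0 := by
  cases m with
  | zero => exact sub_self _
  | succ m => rw [recentredIter_succ, sub_self]

theorem totalVar_recentredIter_le {n : ℕ} (hn : 1 ≤ n) (F : ℕ → ℝ → ℂ) (m : ℕ) :
    totalVar n (recentredIter n F m) ≤ ENNReal.ofReal (beta n)⁻¹ ^ m * totalVar n F := by
  induction m with
  | zero => simpa [recentredIter] using totalVar_recentre_le n F
  | succ m ih =>
    rw [recentredIter, Function.iterate_succ_apply', pow_succ', mul_assoc]
    exact ((totalVar_recentre_le n _).trans (totalVar_transfer_le hn _)).trans (by gcongr; exact ih)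

/-- Recentred functions vanish at the left end of each cell, so their variation bounds them
uniformly. Without recentring the constants would not decay. -/
theorem norm_recentredIter_le {n i : ℕ} (hn : 1 ≤ n) (hi : i < 2 * n + 4) {F : ℕ → ℝ → ℂ}
    (hF : totalVar n F ≠ ∞) (m : ℕ) {x : ℝ} (hx : x ∈ Icc (endpt n i) (endpt n (i + 1))) :
    ‖recentredIter n F m i x‖ ≤ (beta n)⁻¹ ^ m * (totalVar n F).toReal := by
  have h := norm_sub_le_totalVar hi (inv_nonneg.2 (beta_pos n).le) ENNReal.toReal_nonneg
    ((totalVar_recentredIter_le hn F m).trans_eq (by rw [ENNReal.ofReal_toReal hF])) hx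
    (left_mem_Icc.2 (endpt_mono hn (Nat.le_succ i)))
  rwa [recentredIter_endpt, sub_zero] at h

/-- The Neumann series `∑ z⁻¹ ^ (m + 1) K_m` of the recentred iterates. -/
noncomputable def neumann (n : ℕ) (z : ℂ) (F : ℕ → ℝ → ℂ) (i : ℕ) (x : ℝ) : ℂ :=
  ∑' m : ℕ, z⁻¹ ^ (m + 1) * recentredIter n F m i x

theorem summable_geometric_bound {z : ℂ} {b C : ℝ} (hb : 0 < b) (hz : 1 < ‖z‖ * b) :
    Summable fun m : ℕ => ‖z⁻¹‖ ^ (m + 1) * (b⁻¹ ^ m * C) := by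
  have hz0 : 0 ≤ ‖z‖ := norm_nonneg z
  have h : Summable fun m : ℕ => ((‖z‖ * b)⁻¹) ^ m :=
    summable_geometric_of_lt_one (inv_nonneg.2 (mul_nonneg hz0 hb.le)) (inv_lt_one_of_one_lt₀ hz)
  refine (h.mul_right (‖z⁻¹‖ * C)).congr fun m => ?_
  rw [norm_inv, mul_inv, mul_pow, pow_succ]
  ring

theorem hasSum_neumann {n i : ℕ} (hn : 1 ≤ n) (hi : i < 2 * n + 4) {z : ℂ}
    (hz : 1 < ‖z‖ * beta n) {F : ℕ → ℝ → ℂ} (hF : totalVar n F ≠ ∞) {x : ℝ}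
    (hx : x ∈ Icc (endpt n i) (endpt n (i + 1))) :
    HasSum (fun m : ℕ => z⁻¹ ^ (m + 1) * recentredIter n F m i x) (neumann n z F i x) := by
  refine Summable.hasSum (Summable.of_norm_bounded
    (summable_geometric_bound (C := (totalVar n F).toReal) (beta_pos n) hz) fun m => ?_)
  rw [norm_mul, norm_pow]
  gcongr
  exact norm_recentredIter_le hn hi hF m hx

/-- The partial sums have variations bounded by a convergent geometric series, and variation is
lower semicontinuous under pointwise convergence. -/
theorem eVariationOn_neumann_ne_top {n i : ℕ} (hn : 1 ≤ n) (hi : i < 2 * n + 4) {z : ℂ}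
    (hz : 1 < ‖z‖ * beta n) {F : ℕ → ℝ → ℂ} (hF : totalVar n F ≠ ∞) :
    eVariationOn (neumann n z F i) (Icc (endpt n i) (endpt n (i + 1))) ≠ ∞ := by
  have hb := beta_pos n
  set C := (totalVar n F).toReal with hC
  have hC0 : 0 ≤ C := ENNReal.toReal_nonneg
  have hs := summable_geometric_bound (C := C) hb hz
  set a : ℕ → ℝ := fun m => ‖z⁻¹‖ ^ (m + 1) * ((beta n)⁻¹ ^ m * C) with ha
  have ha0 : ∀ m, 0 ≤ a m := fun m => by positivity
  have hterm : ∀ m, eVariationOn (fun x => z⁻¹ ^ (m + 1) * recentredIter n F m i x)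
      (Icc (endpt n i) (endpt n (i + 1))) ≤ ENNReal.ofReal (a m) := by
    intro m
    refine (eVariationOn_const_mul_le _ _ _).trans ?_
    rw [ha, ENNReal.ofReal_mul (by positivity), ENNReal.ofReal_mul (by positivity), ← norm_pow,
      ofReal_norm, ENNReal.ofReal_pow (inv_nonneg.2 hb.le), hC, ENNReal.ofReal_toReal hF]
    gcongr
    refine le_trans ?_ (totalVar_recentredIter_le hn F m)
    exact Finset.single_le_sum
      (f := fun j => eVariationOn (recentredIter n F m j) (Icc (endpt n j) (endpt n (j + 1))))
      (fun _ _ => zero_le) (Finset.mem_range.2 hi)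
  refine ne_top_of_le_ne_top (ENNReal.ofReal_ne_top (r := ∑' m, a m)) ?_
  by_contra hcon
  rw [not_le] at hcon
  obtain ⟨M, hM⟩ := (eVariationOn.lowerSemicontinuous_aux (p := atTop)
    (F := fun M x => ∑ m ∈ Finset.range M, z⁻¹ ^ (m + 1) * recentredIter n F m i x)
    (fun x hx => (hasSum_neumann hn hi hz hF hx).tendsto_sum_nat) hcon).exists
  refine absurd hM (not_lt.2 ?_)
  refine (eVariationOn_sum_le _ _ _).trans ((Finset.sum_le_sum fun m _ => hterm m).trans ?_)
  rw [← ENNReal.ofReal_sum_of_nonneg fun m _ => ha0 m]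
  exact ENNReal.ofReal_le_ofReal (hs.sum_le_tsum _ fun m _ => ha0 m)

theorem hasSum_transfer_neumann {n : ℕ} (hn : 1 ≤ n) {z : ℂ} (hz : 1 < ‖z‖ * beta n)
    {F : ℕ → ℝ → ℂ} (hF : totalVar n F ≠ ∞) (i : ℕ) (x : ℝ) :
    HasSum (fun m : ℕ => z⁻¹ ^ (m + 1) * transfer n (recentredIter n F m) i x)
      (transfer n (neumann n z F) i x) := by
  have h : HasSum (fun m : ℕ => (beta n : ℂ)⁻¹ * ∑ j ∈ Finset.range (2 * n + 4),
      if lo n j ≤ i ∧ i < hi n j then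
        z⁻¹ ^ (m + 1) * recentredIter n F m j (clampBwd n j x) else 0)
      (transfer n (neumann n z F) i x) := by
    refine HasSum.mul_left _ (hasSum_sum fun j hj => ?_)
    split_ifs
    · exact hasSum_neumann hn (Finset.mem_range.1 hj) hz hF (clampBwd_mem hn j x)
    · exact hasSum_zero
  convert h using 2 with m
  rw [transfer, ← mul_assoc, mul_comm (z⁻¹ ^ (m + 1)), mul_assoc, adjAction, Finset.mul_sum]
  congr 1
  exact Finset.sum_congr rfl fun j _ => by split_ifs <;> simp

/-- The series telescopes: up to the constants removed by recentring, the transfer operator sends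
the m-th iterate to the next one, so it acts on the sum as multiplication by z minus the initial
term. The last bracket depends only on the cell. -/
theorem transfer_neumann {n i : ℕ} (hn : 1 ≤ n) (hi : i < 2 * n + 4) {z : ℂ}
    (hz : 1 < ‖z‖ * beta n) {F : ℕ → ℝ → ℂ} (hF : totalVar n F ≠ ∞) {x : ℝ}
    (hx : x ∈ Icc (endpt n i) (endpt n (i + 1))) :
    transfer n (neumann n z F) i x =
      z * neumann n z F i x - F i x +
        (F i (endpt n i) + transfer n (neumann n z F) i (endpt n i)) := by
  have hz0 : z ≠ 0 := by
    rintro rfl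
    norm_num at hz
  have h1 := (hasSum_transfer_neumann hn hz hF i x).sub
    (hasSum_transfer_neumann hn hz hF i (endpt n i))
  have h2 : HasSum (fun m : ℕ => z⁻¹ ^ (m + 1) * recentredIter n F (m + 1) i x)
      (z * neumann n z F i x - recentredIter n F 0 i x) := by
    have h3 := (hasSum_nat_add_iff' 1).2 ((hasSum_neumann hn hi hz hF hx).mul_left z)
    rw [Finset.sum_range_one, zero_add, pow_one, mul_inv_cancel_left₀ hz0] at h3
    have h6 : ∀ m : ℕ, z * (z⁻¹ ^ (m + 1 + 1) * recentredIter n F (m + 1) i x) =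
        z⁻¹ ^ (m + 1) * recentredIter n F (m + 1) i x := fun m => by
      rw [pow_succ' z⁻¹ (m + 1), mul_assoc, mul_inv_cancel_left₀ hz0]
    simp only [h6] at h3
    exact h3
  have h4 : z * neumann n z F i x - recentredIter n F 0 i x =
      transfer n (neumann n z F) i x - transfer n (neumann n z F) i (endpt n i) := by
    simp only [recentredIter_succ, mul_sub] at h2
    exact h2.unique h1
  have h5 : recentredIter n F 0 i x = F i x - F i (endpt n i) := rfl
  rw [h5] at h4
  linear_combination -h4

/-- If `|z| > 1 / β_n`, then every element of `BV` is in the range of `P_n - z` modulo step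
functions. -/
theorem exists_pf_eq {n : ℕ} (hn : 6 ≤ n) {z : ℂ} (hz : 1 < ‖z‖ * beta n) (g : BV) :
    ∃ f v, pf n f = z • f - g + stepBV n v := by
  have hn1 : 1 ≤ n := by omega
  obtain ⟨g', hg, hgg⟩ := g.2
  have hF := totalVar_ne_top hn1 hg
  -- This k solves the equation up to constants on cells, and v collects these constants.
  set k := neumann n z fun _ => g' with hk
  have hkV : totalVar n k ≠ ∞ := (ENNReal.sum_lt_top.2 fun j hj =>
    (eVariationOn_neumann_ne_top hn1 (Finset.mem_range.1 hj) hz hF).lt_top).ne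
  have hbv := bv_glue hn1 hkV
  set v : Fin (2 * n + 4) → ℂ := fun i => g' (endpt n i) + transfer n k i (endpt n i) with hv
  set f := bvMk _ hbv with hf
  refine ⟨f, v, BV_ext ?_⟩
  rw [sub_eq_add_neg, ← neg_one_smul ℂ g]
  filter_upwards [pf_of_glue hn f (coeFn_bvMk _ hbv), coeFn_bvMk _ hbv,
    coeFn_BV_add (z • f + (-1 : ℂ) • g) (stepBV n v), coeFn_BV_add (z • f) ((-1 : ℂ) • g),
    coeFn_BV_smul z f, coeFn_BV_smul (-1) g, hgg, coeFn_stepBV hn1 v, ae_mem_cell hn1]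
    with x e1 e2 e3 e4 e5 e6 e7 e8 e9
  obtain ⟨i, hi, hx⟩ := e9
  rw [e1 i hi hx, e3, e4, e5, e6, e7, e8 i hi hx, e2, glue_apply hn1 hi k (Ioo_subset_Ico_self hx),
    transfer_neumann hn1 hi hz hF (Ioo_subset_Icc_self hx), extVec, dif_pos hi]
  ring

/-! ### From `M_n` to `P_n` -/

/-- The two largest eigenvalues of an operator agree with those of its restriction to a
finite-dimensional invariant subspace if the operator has no spectrum of modulus `> ρ` on the
quotient. -/
theorem IsTopTwo.of_quotient {V W : Type*} [AddCommGroup V] [Module ℂ V] [AddCommGroup W]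
    [Module ℂ W] [FiniteDimensional ℂ W] {L : Module.End ℂ V} {M : Module.End ℂ W}
    {Φ : W →ₗ[ℂ] V} (hΦ : Function.Injective Φ) (hLM : ∀ w, L (Φ w) = Φ (M w)) {ρ : ℝ}
    (hinj : ∀ z : ℂ, ρ < ‖z‖ → ∀ f v, L f = z • f + Φ v → ∃ u, f = Φ u)
    (hsurj : ∀ z : ℂ, ρ < ‖z‖ → ∀ g, ∃ f v, L f = z • f - g + Φ v) {a b : ℂ}
    (hM : IsTopTwo M a b) (hb : ρ < ‖b‖) : IsTopTwo L a b := by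
  have heig : ∀ z, M.HasEigenvalue z → L.HasEigenvalue z := by
    intro z hz
    obtain ⟨w, hw, hw0⟩ := hz.exists_hasEigenvector
    rw [Module.End.mem_eigenspace_iff] at hw
    refine Module.End.hasEigenvalue_of_hasEigenvector (x := Φ w) ⟨?_, ?_⟩
    · rw [Module.End.mem_eigenspace_iff, hLM, hw, map_smul]
    · rwa [Ne, map_eq_zero_iff Φ hΦ]
  have ha : ρ < ‖a‖ := hb.trans hM.lt
  refine ⟨heig a hM.fst, ?_, heig b hM.snd, hM.lt, ?_⟩
  · have hpow : ∀ (k : ℕ) (w : W), ((L - a • 1) ^ k) (Φ w) = Φ (((M - a • 1) ^ k) w) := by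
      intro k
      induction k with
      | zero => intro w; rfl
      | succ k ih =>
        intro w
        rw [pow_succ, pow_succ, Module.End.mul_apply, Module.End.mul_apply, ← ih]
        congr 1
        simp [hLM]
    have hrange : ∀ (k : ℕ) (f : V), ((L - a • 1) ^ k) f = 0 → ∃ u, f = Φ u := by
      intro k
      induction k with
      | zero =>
        intro f hf
        exact ⟨0, by simpa using hf⟩
      | succ k ih =>
        intro f hf
        rw [pow_succ, Module.End.mul_apply] at hf
        obtain ⟨u, hu⟩ := ih _ hf
        refine hinj a ha f u ?_
        rw [← hu]
        simp
    have hmap : L.maxGenEigenspace a = (M.maxGenEigenspace a).map Φ := by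
      ext f
      simp only [Submodule.mem_map, Module.End.mem_maxGenEigenspace]
      constructor
      · rintro ⟨k, hk⟩
        obtain ⟨u, rfl⟩ := hrange k f hk
        refine ⟨u, ⟨k, hΦ ?_⟩, rfl⟩
        -- Injectivity of Φ transports the vanishing of the power back to W.
        rw [← hpow, hk, map_zero]
      · rintro ⟨u, ⟨k, hk⟩, rfl⟩
        exact ⟨k, by rw [hpow, hk, map_zero]⟩
    rw [hmap, ← (Submodule.equivMapOfInjective Φ hΦ _).finrank_eq, hM.simple]
  · intro z hz hza hzb
    rcases le_or_gt ‖z‖ ρ with h | h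
    · exact h.trans_lt hb
    -- Outside the disc of radius ρ, invertibility of z - M implies that of z - L: the quotient is
    -- already invertible there.
    refine hM.rest z (fun hu => hz ?_) hza hzb
    have hu' : Function.Bijective (algebraMap ℂ (Module.End ℂ W) z - M) :=
      (Module.End.isUnit_iff _).1 hu
    change IsUnit _
    rw [Module.End.isUnit_iff]
    constructor
    · refine (injective_iff_map_eq_zero _).2 fun f hf => ?_
      rw [LinearMap.sub_apply, Module.algebraMap_end_apply, sub_eq_zero] at hf
      obtain ⟨u, rfl⟩ := hinj z h f 0 (by rw [map_zero, add_zero, hf])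
      have : u = 0 := by
        refine hu'.1 ?_
        rw [map_zero, LinearMap.sub_apply, Module.algebraMap_end_apply]
        refine hΦ ?_
        rw [map_sub, map_smul, ← hLM, hf, sub_self, map_zero]
      rw [this, map_zero]
    · intro g
      obtain ⟨f, v, hf⟩ := hsurj z h g
      obtain ⟨u, hu⟩ := hu'.2 v
      -- The error Φ v of the solution modulo Φ(W) is corrected by u = (z - M)⁻¹ v.
      refine ⟨f + Φ u, ?_⟩
      rw [LinearMap.sub_apply, Module.algebraMap_end_apply] at hu
      rw [LinearMap.sub_apply, Module.algebraMap_end_apply, map_add, hf, hLM, ← hu, map_sub,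
        map_smul, smul_add]
      abel

theorem pf_isTopTwo {n : ℕ} (hn : 6 ≤ n) {w : ℝ} (h1 : 3 / 2 < w) (h2 : w < 2)
    (h3 : w ^ n * (2 - w) = 2) : IsTopTwo (pf n) 1 ((w / beta n : ℝ) : ℂ) := by
  have hb := beta_pos n
  have hlt : ∀ z : ℂ, (beta n)⁻¹ < ‖z‖ → 1 < ‖z‖ * beta n := fun z hz => by
    rwa [inv_eq_one_div, div_lt_iff₀ hb] at hz
  refine IsTopTwo.of_quotient (ρ := (beta n)⁻¹) (stepBV_injective (by omega)) (pf_stepBV hn)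
    (fun z hz f v h => mem_range_stepBV hn (hlt z hz) h) (fun z hz => exists_pf_eq hn (hlt z hz))
    (markov_isTopTwo hn h1 h2 h3) ?_
  -- The second eigenvalue w/β lies outside the disc of radius 1/β because w > 3/2 > 1.
  rw [Complex.norm_real, Real.norm_of_nonneg (by positivity), inv_eq_one_div]
  gcongr
  linarith

/-! ### Asymptotics -/

theorem IsTopTwo.mixingTime_eq {V : Type*} [AddCommGroup V] [Module ℂ V] {L : Module.End ℂ V}
    {b : ℂ} (h : IsTopTwo L 1 b) : mixingTime L = 1 / |Real.log ‖b‖| := by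
  have hg : IsGreatest (norm '' (spectrum ℂ L \ {1})) ‖b‖ := by
    refine ⟨⟨b, ⟨h.snd.mem_spectrum, ?_⟩, rfl⟩, ?_⟩
    · rintro rfl
      exact lt_irrefl _ h.lt
    · rintro _ ⟨z, ⟨hz, hz1⟩, rfl⟩
      by_cases hb : z = b
      · rw [hb]
      · exact (h.rest z hz hz1 hb).le
  rw [mixingTime, hg.csSup_eq]

/-- The root of `w ^ n (2 - w) = 2` in `(3 / 2, 2)`. -/
noncomputable def subRoot (n : ℕ) : ℝ :=
  if h : 6 ≤ n then (exists_subdominant_root h).choose else 0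

theorem subRoot_spec {n : ℕ} (hn : 6 ≤ n) :
    3 / 2 < subRoot n ∧ subRoot n < 2 ∧ subRoot n ^ n * (2 - subRoot n) = 2 := by
  rw [subRoot, dif_pos hn]
  exact (exists_subdominant_root hn).choose_spec

/-- Half the distance of `subRoot n` from `2`. -/
noncomputable def gap (n : ℕ) : ℝ := (2 - subRoot n) / 2

theorem gap_pos {n : ℕ} (hn : 6 ≤ n) : 0 < gap n := by
  obtain ⟨-, h, -⟩ := subRoot_spec hn
  unfold gap
  linarith

theorem two_pow_mul_kappa (n : ℕ) : 2 ^ n * kappa n * (1 + kappa n) ^ n = 1 := by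
  have := beta_pow_mul_kappa n
  rw [beta, mul_pow] at this
  linear_combination this

theorem two_pow_mul_gap {n : ℕ} (hn : 6 ≤ n) : 2 ^ n * gap n * (1 - gap n) ^ n = 1 := by
  obtain ⟨-, -, h⟩ := subRoot_spec hn
  have h2 : (2 : ℝ) ^ n * (1 - gap n) ^ n = subRoot n ^ n := by
    rw [← mul_pow, gap]
    ring
  have h3 : 2 - subRoot n = 2 * gap n := by
    rw [gap]
    ring
  rw [h3] at h
  linear_combination h / 2 + gap n * h2

/-! ### The sizes of κ_n and of the gap -/

theorem kappa_le_two_inv_pow (n : ℕ) : kappa n ≤ (1 / 2) ^ n := by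
  have h := two_pow_mul_kappa n
  have h0 := kappa_pos n
  have h1 : 1 ≤ (1 + kappa n) ^ n := one_le_pow₀ (by linarith)
  have h2 : 0 < 2 ^ n * kappa n := by positivity
  have h3 : 2 ^ n * kappa n ≤ 1 := by nlinarith
  rw [one_div, inv_pow, inv_eq_one_div, le_div_iff₀ (by positivity)]
  linarith

theorem tendsto_kappa : Tendsto kappa atTop (nhds 0) :=
  squeeze_zero (fun n => (kappa_pos n).le) kappa_le_two_inv_pow
    (tendsto_pow_atTop_nhds_zero_of_lt_one (by norm_num) (by norm_num))

/-- The factor (1 + κ)^n lies between 1 and exp(nκ), and nκ → 0. -/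
theorem tendsto_two_pow_mul_kappa :
    Tendsto (fun n => 2 ^ n * kappa n) atTop (nhds 1) := by
  have h0 : Tendsto (fun n : ℕ => (n : ℝ) * kappa n) atTop (nhds 0) :=
    squeeze_zero (fun n => mul_nonneg n.cast_nonneg (kappa_pos n).le)
      (fun n => mul_le_mul_of_nonneg_left (kappa_le_two_inv_pow n) n.cast_nonneg)
      (tendsto_self_mul_const_pow_of_lt_one (by norm_num) (by norm_num))
  have h1 : Tendsto (fun n : ℕ => Real.exp (-((n : ℝ) * kappa n))) atTop (nhds 1) := by
    have := (Real.continuous_exp.tendsto _).comp h0.neg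
    rwa [neg_zero, Real.exp_zero] at this
  refine tendsto_of_tendsto_of_tendsto_of_le_of_le h1 tendsto_const_nhds (fun n => ?_) fun n => ?_
  · have hk := kappa_pos n
    have h2 : (1 + kappa n) ^ n ≤ Real.exp (n * kappa n) := by
      rw [Real.exp_nat_mul]
      refine pow_le_pow_left₀ (by linarith) ?_ n
      linarith [Real.add_one_le_exp (kappa n)]
    have h3 : 2 ^ n * kappa n = ((1 + kappa n) ^ n)⁻¹ :=
      eq_inv_of_mul_eq_one_left (two_pow_mul_kappa n)
    simp only
    rw [h3, Real.exp_neg]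
    exact inv_anti₀ (by positivity) h2
  · have := mul_le_mul_of_nonneg_left (kappa_le_two_inv_pow n) (show (0 : ℝ) ≤ 2 ^ n by positivity)
    rwa [← mul_pow, show (2 : ℝ) * (1 / 2) = 1 by norm_num, one_pow] at this

/-- A crude bound from w > 3/2; it suffices to make n · `gap n` tend to 0. -/
theorem gap_le {n : ℕ} (hn : 6 ≤ n) : gap n ≤ (2 / 3) ^ n := by
  obtain ⟨h1, h2, h3⟩ := subRoot_spec hn
  have h4 : (3 / 2 : ℝ) ^ n ≤ subRoot n ^ n := pow_le_pow_left₀ (by norm_num) h1.le n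
  have h5 : (3 / 2 : ℝ) ^ n * (2 / 3) ^ n = 1 := by
    rw [← mul_pow]
    norm_num
  have h6 : (0 : ℝ) < (2 / 3) ^ n := by positivity
  have h7 : (3 / 2 : ℝ) ^ n * ((2 - subRoot n) / 2) ≤ 1 := by
    have := mul_le_mul_of_nonneg_right h4 (show 0 ≤ 2 - subRoot n by linarith)
    linarith
  calc gap n = (2 / 3) ^ n * ((3 / 2 : ℝ) ^ n * ((2 - subRoot n) / 2)) := by
        rw [gap]
        linear_combination -((2 - subRoot n) / 2) * h5
    _ ≤ (2 / 3) ^ n * 1 := mul_le_mul_of_nonneg_left h7 h6.le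
    _ = _ := mul_one _

theorem tendsto_nat_mul_gap : Tendsto (fun n : ℕ => (n : ℝ) * gap n) atTop (nhds 0) := by
  refine squeeze_zero' ?_ ?_
    (tendsto_self_mul_const_pow_of_lt_one (r := 2 / 3) (by norm_num) (by norm_num))
  · filter_upwards [eventually_ge_atTop 6] with n hn
    exact mul_nonneg n.cast_nonneg (gap_pos hn).le
  · filter_upwards [eventually_ge_atTop 6] with n hn
    exact mul_le_mul_of_nonneg_left (gap_le hn) n.cast_nonneg

theorem tendsto_gap : Tendsto gap atTop (nhds 0) := by
  refine squeeze_zero' ?_ ?_ (tendsto_pow_atTop_nhds_zero_of_lt_one (r := (2 / 3 : ℝ))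
    (by norm_num) (by norm_num))
  · filter_upwards [eventually_ge_atTop 6] with n hn using (gap_pos hn).le
  · filter_upwards [eventually_ge_atTop 6] with n hn using gap_le hn

/-- Bernoulli's inequality puts (1 - δ)^n between 1 - nδ and 1, with nδ → 0. -/
theorem tendsto_two_pow_mul_gap : Tendsto (fun n => 2 ^ n * gap n) atTop (nhds 1) := by
  have h1 : Tendsto (fun n : ℕ => (1 - (n : ℝ) * gap n)⁻¹) atTop (nhds 1) := by
    have := (tendsto_nat_mul_gap.const_sub 1).inv₀ (by norm_num)
    simpa using this
  have hlt : ∀ᶠ n : ℕ in atTop, (n : ℝ) * gap n < 1 :=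
    tendsto_nat_mul_gap.eventually_lt_const one_pos
  refine tendsto_of_tendsto_of_tendsto_of_le_of_le' tendsto_const_nhds h1 ?_ ?_
  · filter_upwards [eventually_ge_atTop 6] with n hn
    obtain ⟨h2, h3, -⟩ := subRoot_spec hn
    have h4 := two_pow_mul_gap hn
    have h5 : (1 - gap n) ^ n ≤ 1 :=
      pow_le_one₀ (by unfold gap; linarith) (by linarith [gap_pos hn])
    have h6 : 0 < 2 ^ n * gap n := mul_pos (by positivity) (gap_pos hn)
    nlinarith
  · filter_upwards [eventually_ge_atTop 6, hlt] with n hn hlt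
    obtain ⟨h2, h3, -⟩ := subRoot_spec hn
    have h4 := two_pow_mul_gap hn
    have h5 : 1 + (n : ℝ) * (-gap n) ≤ (1 + -gap n) ^ n :=
      one_add_mul_le_pow (by unfold gap; linarith) n
    have h6 : 0 < 2 ^ n * gap n := mul_pos (by positivity) (gap_pos hn)
    rw [inv_eq_one_div, le_div_iff₀ (by linarith)]
    refine le_of_le_of_eq ?_ h4
    refine mul_le_mul_of_nonneg_left ?_ h6.le
    rw [sub_eq_add_neg 1 (gap n)]
    linarith

/-- The second-largest eigenvalue. -/
noncomputable def subEigenvalue (n : ℕ) : ℝ := subRoot n / beta n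

theorem subEigenvalue_eq (n : ℕ) : subEigenvalue n = (1 - gap n) / (1 + kappa n) := by
  have h : (1 + kappa n) ≠ 0 := by linarith [kappa_pos n]
  rw [subEigenvalue, gap, beta]
  field_simp
  ring

theorem tendsto_subEigenvalue : Tendsto subEigenvalue atTop (nhds 1) := by
  have h := (tendsto_gap.const_sub 1).div (tendsto_kappa.const_add 1) (by norm_num)
  simp only [sub_zero, add_zero, div_one] at h
  exact h.congr fun n => (subEigenvalue_eq n).symm

theorem subEigenvalue_isLittleO :
    (fun n => subEigenvalue n - (1 - 2 * kappa n)) =o[atTop] kappa := by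
  rw [isLittleO_iff_tendsto fun n h => absurd h (kappa_pos n).ne']
  -- With δ the gap, the quotient equals (1 - δ/κ + 2κ)/(1 + κ), and δ/κ → 1.
  have h := ((((tendsto_two_pow_mul_gap.div tendsto_two_pow_mul_kappa one_ne_zero).const_sub 1).add
    (tendsto_kappa.const_mul 2)).div (tendsto_kappa.const_add 1) (by norm_num))
  norm_num at h
  refine h.congr fun n => ?_
  have h0 := kappa_pos n
  have h1 : (1 + kappa n) ≠ 0 := by linarith
  rw [subEigenvalue_eq]
  simp only [Pi.div_apply]
  field_simp
  ring

theorem subEigenvalue_isEquivalent :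
    subEigenvalue ~[atTop] fun n => 1 - 2 * kappa n := by
  have h1 : subEigenvalue ~[atTop] fun _ => (1 : ℝ) :=
    (isEquivalent_const_iff_tendsto one_ne_zero).2 tendsto_subEigenvalue
  have h2 : (fun n => 1 - 2 * kappa n) ~[atTop] fun _ => (1 : ℝ) := by
    refine (isEquivalent_const_iff_tendsto one_ne_zero).2 ?_
    simpa using (tendsto_kappa.const_mul 2).const_sub 1
  exact h1.trans h2.symm

theorem subEigenvalue_pos_lt_one {n : ℕ} (hn : 6 ≤ n) :
    0 < subEigenvalue n ∧ subEigenvalue n < 1 := by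
  obtain ⟨h1, h2, -⟩ := subRoot_spec hn
  have h3 := two_lt_beta n
  have h4 := beta_pos n
  unfold subEigenvalue
  exact ⟨by positivity, by rw [div_lt_one h4]; linarith⟩

/-- With μ the eigenvalue, log μ is asymptotic to μ - 1 = -(δ + κ)/(1 + κ). As δ and κ are each
asymptotic to 2^(-n), their sum accounts for the exponent n - 1. -/
theorem tendsto_two_pow_mul_log :
    Tendsto (fun n => (2 : ℝ) ^ (n - 1) * |Real.log (subEigenvalue n)|) atTop (nhds 1) := by
  have hslope : Tendsto (fun n => slope Real.log 1 (subEigenvalue n)) atTop (nhds 1) := by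
    have h := (Real.hasDerivAt_log one_ne_zero).tendsto_slope
    rw [inv_one] at h
    refine h.comp (tendsto_nhdsWithin_iff.2 ⟨tendsto_subEigenvalue, ?_⟩)
    filter_upwards [eventually_ge_atTop 6] with n hn
    exact (subEigenvalue_pos_lt_one hn).2.ne
  have hlin := ((tendsto_two_pow_mul_gap.add tendsto_two_pow_mul_kappa).div
    (tendsto_kappa.const_add 1) (by norm_num)).div_const 2
  have h := hslope.mul hlin
  norm_num at h
  refine h.congr' ?_
  filter_upwards [eventually_ge_atTop 6] with n hn
  obtain ⟨h1, h2⟩ := subEigenvalue_pos_lt_one hn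
  have h3 : subEigenvalue n - 1 ≠ 0 := by linarith
  have h4 : 1 + kappa n ≠ 0 := by linarith [kappa_pos n]
  have h5 : (2 : ℝ) ^ n = 2 * 2 ^ (n - 1) := by
    rw [← pow_succ', Nat.sub_add_cancel (by omega)]
  have h6 : (2 ^ n * gap n + 2 ^ n * kappa n) / (1 + kappa n) / 2 =
      2 ^ (n - 1) * -(subEigenvalue n - 1) := by
    rw [subEigenvalue_eq, h5]
    field_simp
    ring
  rw [abs_of_neg (Real.log_neg h1 h2), slope_def_field, Real.log_one, sub_zero]
  rw [h6]
  field_simp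

theorem mixingTime_isEquivalent :
    (fun n => mixingTime (pf n)) ~[atTop] fun n => (2 : ℝ) ^ (n - 1) := by
  refine isEquivalent_of_tendsto_one ?_
  have h := tendsto_two_pow_mul_log.inv₀ one_ne_zero
  rw [inv_one] at h
  refine h.congr' ?_
  filter_upwards [eventually_ge_atTop 6] with n hn
  obtain ⟨h1, h2, h3⟩ := subRoot_spec hn
  have h4 : mixingTime (pf n) = 1 / |Real.log ‖((subEigenvalue n : ℝ) : ℂ)‖| :=
    (pf_isTopTwo hn h1 h2 h3).mixingTime_eq
  rw [Pi.div_apply, h4, Complex.norm_real,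
    Real.norm_of_nonneg (subEigenvalue_pos_lt_one hn).1.le, mul_inv, div_div, one_div, mul_inv,
    mul_comm]

end PairedTent

theorem mainTheorem3 :
    ∃ μ : ℕ → ℝ,
      (∀ n, 6 ≤ n →
        PairedTent.IsTopTwo (Matrix.toLin' (PairedTent.markovMatrix n)) 1 (μ n : ℂ) ∧
        PairedTent.IsTopTwo (PairedTent.pf n) 1 (μ n : ℂ)) ∧
      μ ~[atTop] (fun n => 1 - 2 * PairedTent.kappa n) ∧
      (fun n => μ n - (1 - 2 * PairedTent.kappa n)) =o[atTop] PairedTent.kappa ∧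
      (fun n => PairedTent.mixingTime (PairedTent.pf n)) ~[atTop] (fun n => (2 : ℝ) ^ (n - 1)) := by
  refine ⟨PairedTent.subEigenvalue, fun n hn => ?_, PairedTent.subEigenvalue_isEquivalent,
    PairedTent.subEigenvalue_isLittleO, PairedTent.mixingTime_isEquivalent⟩
  obtain ⟨h1, h2, h3⟩ := PairedTent.subRoot_spec hn
  exact ⟨PairedTent.markov_isTopTwo hn h1 h2 h3, PairedTent.pf_isTopTwo hn h1 h2 h3⟩
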